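/- **Setting.** Let $\sigma(x)=\max\{0,x\}$, and let $\sigma_{\rm EUAF}(x)=|x-2\lfloor (x+1)/2\rfloor|$ for $x\ge 0$, $\sigma_{\rm EUAF}(x)=x/(1+|x|)$ for $x<0$; activations act entrywise. Let $D=4d+8$. A transformer layer maps a token matrix $H=[h_1,\dots,h_n]\in\mathbb R^{D\times n}$ (any $n$) to ${\rm FFN}({\rm Attn}(H))$, where $${\rm Attn}(H)_j=h_j+\sum_{m=1}^{M}\sum_{j'=1}^{n}\sigma(\langle Q_mh_j,K_mh_{j'}\rangle)V_mh_{j'},\qquad {\rm FFN}(H)=H+W_2\,\sigma(W_1H),$$ with $Q_m,K_m,V_m\in\mathbb R^{D\times D}$, $W_1\in\mathbb R^{D'\times D}$, $W_2\in\mathbb R^{D\times D'}$; $M$ is the number of heads and $D'$ the FFN width. ${\rm TF}_\Theta$ denotes a composition of such layers in which the activation of the FFN of the first layer is replaced by $\sigma_{\rm EUAF}$. Let $\|\Theta\|_0$ be the number of nonzero entries and $\|\Theta\|_{\max}$ the largest absolute value of an entry of all the parameter matrices. Given an initial sequence $h_1,\dots,h_n$, the transformer generates $h_{m+1}={\rm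 TF}_\Theta([h_1,\dots,h_m])_m$ (the last column) for $m=n,n+1,\dots$. For $w\in\mathbb Z$, $j\in\mathbb N$, $S>0$ let $p(w,j,S)=(\mathbf 0_{3d+4}^\top,1,S,Sw,Sj)^\top\in\mathbb R^{3d+8}$. For $\mathcal U\subset\mathbb R^d$, $\mathcal P_{\mathcal U}(T,L,S)$ is the set of prompts $[h_1,\dots,h_T]$ with $h_j=(u_j^\top,p(w_j,j,S)^\top)^\top$, $u_j\in\mathcal U$, $w_j\in\{1,\dots,2L\}$ (for $T=0$ the empty prompt). For $z_1,\dots,z_N\in[0,1]^d$ the data tokens following such a prompt are $h_{T+i}=(z_i^\top,p(0,T+i,S)^\top)^\top$, $i=1,\dots,N$. Let $\mathcal B_d(B)$ be the closed Euclidean ball of radius $B$ about $0$, and let $\mathcal W(r,d,\mathcal U,B)$ be the set of $W=\sum_{k=1}^r\tilde u_ku_k^\top\in\mathbb R^{d\times d}$ with $\tilde u_k,u_k\in\mathcal U$ and operator norm $\|W\|\le B^2$. **Theorem.** There is an absolute constant $C$ such that for every integer $d\ge 1$ there is an $8$-layer transformer ${\rm TF}_{\Theta^\#}$ as above, depending only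 on $d$, with the following properties. 1. Every attention layer has at most $8$ heads, every FFN has width at most $Cd$, $\|\Theta^\#\|_0\le Cd$, and $\|\Theta^\#\|_{\max}\le C$. 2. Let $B\ge1$, let $L,T\ge1$ be integers, $\mathcal U\subset\mathcal B_d(B)$, and $S\ge\max\{dB^{4L}T^{2L},2L\}$. For every prompt $H^{\rm P}=[h_1,\dots,h_T]\in\mathcal P_{\mathcal U}(T,L,S)$ with embeddings $u_j$ and indices $w_j$, every $N\ge1$ and all $z_1,\dots,z_N\in[0,1]^d$, the tokens generated by ${\rm TF}_{\Theta^\#}$ from the prompt followed by the $N$ data tokens satisfy, for all $1\le i\le N$, $1\le\ell\le L$, $$h_{T+N\ell+i}=\begin{pmatrix}W^{\rm P}_\ell\,\sigma_{\rm EUAF}(W^{\rm P}_{\ell-1}\,\sigma_{\rm EUAF}(\cdots\sigma_{\rm EUAF}(W^{\rm P}_{1,i}z_i)\cdots))\\ p(-\ell,T+N\ell+i,S)\end{pmatrix},$$ (for $\ell=1$ the upper block is $W^{\rm P}_{1,i}z_i$), where for $\ell\ge2$ $$W^{\rm P}_\ell=\sum_{j=1}^{T-1}\mathbb I\{w_j=2\ell-1,\,w_{j+1}=2\ell\}\,u_ju_{j+1}^\top,$$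 $$W^{\rm P}_{1,i}=\sum_{j=1}^{T-1}\mathbb I\{w_j=1,\,w_{j+1}=2\}\,u_ju_{j+1}^\top+\mathbb I\{i=1\}\,\mathbb I\{w_T=1\}\,u_T\sum_{j=1}^{T}\mathbb I\{w_j=1\}\,u_j^\top .$$ 3. Let $B\ge1$, let $L\ge1$ be an integer, let $r_1,\dots,r_L\ge0$ be integers with $\bar r=\max_\ell r_\ell$, let $\mathcal U\subset\mathcal B_d(B)$ and $W_\ell\in\mathcal W(r_\ell,d,\mathcal U,B)$ for $1\le\ell\le L$. Put $T=2\sum_{\ell=1}^Lr_\ell$. For every $S\ge\max\{d\,\bar r\,B^{4L},2L\}$ there is a prompt $H^{\rm P}\in\mathcal P_{\mathcal U}(T,L,S)$ such that for every $N\ge1$ and all $z_1,\dots,z_N\in[0,1]^d$ the tokens generated by the same ${\rm TF}_{\Theta^\#}$ from the prompt followed by the $N$ data tokens satisfy, for all $1\le i\le N$, $1\le\ell\le L$, $$h_{T+N\ell+i}=\begin{pmatrix}W_\ell\,\sigma_{\rm EUAF}(W_{\ell-1}\,\sigma_{\rm EUAF}(\cdots\sigma_{\rm EUAF}(W_1z_i)\cdots))\\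 p(-\ell,T+N\ell+i,S)\end{pmatrix}.$$ -/

import Mathlib

open scoped Matrix

noncomputable section

/-- The ReLU activation. -/
def relu (x : ℝ) : ℝ := max 0 x

/-- The elementary universal activation function: the sawtooth `|x - 2⌊(x+1)/2⌋|` for `x ≥ 0`
and the soft-sign `x / (1 + |x|)` for `x < 0`. -/
def euaf (x : ℝ) : ℝ :=
  if 0 ≤ x then |x - 2 * (⌊(x + 1) / 2⌋ : ℝ)| else x / (1 + |x|)

/-! ### Transformers -/

/-- Parameters of one transformer layer on `D`-dimensional tokens: the query, key and value
matrices of the attention heads, and the two weight matrices of the feed-forward network. -/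
structure TFLayer (D : ℕ) where
  heads : ℕ
  Q : Fin heads → Matrix (Fin D) (Fin D) ℝ
  K : Fin heads → Matrix (Fin D) (Fin D) ℝ
  V : Fin heads → Matrix (Fin D) (Fin D) ℝ
  width : ℕ
  W₁ : Matrix (Fin width) (Fin D) ℝ
  W₂ : Matrix (Fin D) (Fin width) ℝ

/-- ReLU self-attention with residual connection, on a sequence of `n` tokens:
`Attn(H)_j = h_j + ∑_m ∑_{j'} relu ⟨Q_m h_j, K_m h_{j'}⟩ V_m h_{j'}`. -/
def TFLayer.attn {D : ℕ} (θ : TFLayer D) {n : ℕ} (H : Fin n → Fin D → ℝ) :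
    Fin n → Fin D → ℝ := fun j =>
  H j + ∑ m : Fin θ.heads, ∑ k : Fin n,
    relu ((θ.Q m *ᵥ H j) ⬝ᵥ (θ.K m *ᵥ H k)) • (θ.V m *ᵥ H k)

/-- Token-wise feed-forward network `h ↦ h + W₂ σ(W₁ h)` with activation `σ`. -/
def TFLayer.ffn {D : ℕ} (θ : TFLayer D) (σ : ℝ → ℝ) {n : ℕ} (H : Fin n → Fin D → ℝ) :
    Fin n → Fin D → ℝ := fun j =>
  H j + θ.W₂ *ᵥ (fun i => σ ((θ.W₁ *ᵥ H j) i))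

/-- The transformer with parameters `Θ` (first layer at the head of the list), in which the first
feed-forward network uses the activation `euaf` and all other activations are ReLU. -/
def euafTransformer {D : ℕ} (Θ : List (TFLayer D)) {n : ℕ} (H : Fin n → Fin D → ℝ) :
    Fin n → Fin D → ℝ :=
  match Θ with
  | [] => H
  | θ :: Θ' => Θ'.foldl (fun G θ' => θ'.ffn relu (θ'.attn G)) (θ.ffn euaf (θ.attn H))

/-- Sequential generation from the initial sequence `H` of length `n`: the infinite sequence of
tokens (numbered from `0`) that starts with `H` and in which every later token is the last column
of the output of the transformer on all the tokens before it.
(The value `0` occurs only for the empty initial sequence.) -/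
def generatedToken {D : ℕ} (Θ : List (TFLayer D)) {n : ℕ} (H : Fin n → Fin D → ℝ) :
    ℕ → Fin D → ℝ
  | 0 => if h : 0 < n then H ⟨0, h⟩ else 0
  | j + 1 =>
    if h : j + 1 < n then H ⟨j + 1, h⟩
    else euafTransformer Θ (fun i : Fin (j + 1) => generatedToken Θ H i) (Fin.last j)
  termination_by j => j
  decreasing_by exact i.isLt

/-- Number of nonzero entries of a matrix. -/
def entryCount {a b : ℕ} (A : Matrix (Fin a) (Fin b) ℝ) : ℕ :=
  Set.ncard {p : Fin a × Fin b | A p.1 p.2 ≠ 0}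

/-- Largest absolute value of an entry of a matrix (`0` for an empty matrix). -/
def entryMax {a b : ℕ} (A : Matrix (Fin a) (Fin b) ℝ) : NNReal :=
  Finset.univ.sup fun p : Fin a × Fin b => ‖A p.1 p.2‖₊

/-- `‖Θ‖₀`: the number of nonzero parameters. -/
def paramCount {D : ℕ} (Θ : List (TFLayer D)) : ℕ :=
  (Θ.map fun θ => entryCount θ.W₁ + entryCount θ.W₂ +
    ∑ m : Fin θ.heads, (entryCount (θ.Q m) + entryCount (θ.K m) + entryCount (θ.V m))).sum

/-- `‖Θ‖_max`: the largest absolute value of a parameter. -/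
def paramMax {D : ℕ} (Θ : List (TFLayer D)) : NNReal :=
  (Θ.map fun θ => entryMax θ.W₁ ⊔ entryMax θ.W₂ ⊔
    Finset.univ.sup fun m : Fin θ.heads =>
      entryMax (θ.Q m) ⊔ entryMax (θ.K m) ⊔ entryMax (θ.V m)).foldr max 0

/-! ### Prompts and data tokens -/

/-- The token `(x, p(w, j, S))` of dimension `4d + 8`, with word embedding `x` and positional
encoding `p(w, j, S) = (0_{3d+4}, 1, S, S w, S j)`. -/
def token {d : ℕ} (x : Fin d → ℝ) (w : ℤ) (j : ℕ) (S : ℝ) : Fin (4 * d + 8) → ℝ := fun k =>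
  if h : (k : ℕ) < d then x ⟨k, h⟩
  else if (k : ℕ) = 4 * d + 4 then 1
  else if (k : ℕ) = 4 * d + 5 then S
  else if (k : ℕ) = 4 * d + 6 then S * w
  else if (k : ℕ) = 4 * d + 7 then S * j
  else 0

/-- Word embeddings `u₁, …, u_T` and layer indices `w₁, …, w_T` of a prompt in
`𝒫_𝒰(T, L, S)`: all `u_j ∈ 𝒰` and all `w_j ∈ {1, …, 2L}`. -/
def IsPrompt {d T : ℕ} (U : Set (EuclideanSpace ℝ (Fin d))) (L : ℕ)
    (u : Fin T → EuclideanSpace ℝ (Fin d)) (w : Fin T → ℤ) : Prop :=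
  (∀ j, u j ∈ U) ∧ ∀ j, 1 ≤ w j ∧ w j ≤ 2 * (L : ℤ)

/-- The initial input: the `T` prompt tokens `(u_j, p(w_j, j, S))`, `j = 1, …, T`, followed by the
`N` data tokens `(z_i, p(0, T + i, S))`, `i = 1, …, N`. -/
def inputSequence {d T N : ℕ} (u : Fin T → EuclideanSpace ℝ (Fin d)) (w : Fin T → ℤ)
    (z : Fin N → Fin d → ℝ) (S : ℝ) : Fin (T + N) → Fin (4 * d + 8) → ℝ :=
  Fin.append (fun j : Fin T => token (u j).ofLp (w j) ((j : ℕ) + 1) S)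
    (fun i : Fin N => token (z i) 0 (T + ((i : ℕ) + 1)) S)

/-! ### Virtual networks -/

/-- Output `W_ℓ σ(W_{ℓ-1} σ(⋯ σ(W₁ z) ⋯))` of the `ℓ`-th layer of the network with weight matrices
`W 1, W 2, …` and activation `σ`, applied entrywise; the input `z` itself for `ℓ = 0`. -/
def networkLayer {d : ℕ} (σ : ℝ → ℝ) (W : ℕ → Matrix (Fin d) (Fin d) ℝ) (z : Fin d → ℝ) :
    ℕ → Fin d → ℝ
  | 0 => z
  | 1 => W 1 *ᵥ z
  | ℓ + 2 => W (ℓ + 2) *ᵥ (fun k => σ (networkLayer σ W z (ℓ + 1) k))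

/-- `∑_{j ∈ [T-1]} u_j 𝟙{w_j = 2ℓ-1} u_{j+1}ᵀ 𝟙{w_{j+1} = 2ℓ}`. -/
def pairWeight {d T : ℕ} (u : Fin T → EuclideanSpace ℝ (Fin d)) (w : Fin T → ℤ) (ℓ : ℕ) :
    Matrix (Fin d) (Fin d) ℝ :=
  ∑ j : Fin T, ∑ k : Fin T,
    if (k : ℕ) = (j : ℕ) + 1 ∧ w j = 2 * (ℓ : ℤ) - 1 ∧ w k = 2 * (ℓ : ℤ) then
      Matrix.vecMulVec (u j).ofLp (u k).ofLp
    else 0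

/-- `u_T 𝟙{w_T = 1} ∑_{k ∈ [T]} u_kᵀ 𝟙{w_k = 1}`. -/
def tailWeight {d T : ℕ} (u : Fin T → EuclideanSpace ℝ (Fin d)) (w : Fin T → ℤ) :
    Matrix (Fin d) (Fin d) ℝ :=
  ∑ j : Fin T, ∑ k : Fin T,
    if (j : ℕ) + 1 = T ∧ w j = 1 ∧ w k = 1 then
      Matrix.vecMulVec (u j).ofLp (u k).ofLp
    else 0

/-- Weight matrix of the `ℓ`-th layer of the virtual network encoded by the prompt, as it acts on
the data token number `i` (counted from `0`): the tail term enters only in the first layer and for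
the first data token. -/
def promptWeight {d T : ℕ} (u : Fin T → EuclideanSpace ℝ (Fin d)) (w : Fin T → ℤ) (i ℓ : ℕ) :
    Matrix (Fin d) (Fin d) ℝ :=
  pairWeight u w ℓ + if ℓ = 1 ∧ i = 0 then tailWeight u w else 0

/-- The coarse weight matrices `𝒲(r, d, 𝒰, B)`: sums of `r` rank-one matrices `ũ uᵀ` with
`ũ, u ∈ 𝒰`, of (Euclidean) operator norm at most `B²`. -/
def coarseWeights {d : ℕ} (r : ℕ) (U : Set (EuclideanSpace ℝ (Fin d))) (B : ℝ) :
    Set (Matrix (Fin d) (Fin d) ℝ) :=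
  {W | (∃ u' u : Fin r → EuclideanSpace ℝ (Fin d), (∀ k, u' k ∈ U) ∧ (∀ k, u k ∈ U) ∧
      W = ∑ k, Matrix.vecMulVec (u' k).ofLp (u k).ofLp) ∧
    ‖Matrix.toEuclideanCLM (n := Fin d) (𝕜 := ℝ) W‖ ≤ B ^ 2}

end

noncomputable section

/-! ### Sparse matrices -/

/-! ReLU attention can test integer equations exactly. The difference relu(a+b) - relu(b) is a for b
≥ |a| and 0 for b ≤ -|a|; subtracting its value at b = 2τ - S from that at b = 2τ + S gives `gate`,
four heads that pass the content a when τ = 0 and nothing when τ is another integer multiple of S,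
as long as |a| ≤ S (`gate_int`). Since positions and indices are stored multiplied by S, attention
sums exactly over the tokens that satisfy a linear integer equation. An equation t = 0 is combined
with a condition of indicator e ∈ {0,1} as 2t + e = 0.

Six layers suffice; two zero layers pad. Counting the tokens of index 0 yields N, which locates the
token p that is N - 1 places before the last one: it carries the previous virtual layer ℓ for the
same data token. Its activated embedding y and its index -ℓ are copied to the last token. Each token
also fetches its predecessor if that lies in the prompt, so the summand u_{k-1} u_kᵀ y becomes one
attention term: score ⟨y, u_k⟩ times value u_{k-1}. Selecting w_k = 2ℓ + 2 and w_{k-1} = w_k - 1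
gives the pair weights. The tail term is a scalar, the sum of ⟨y, u_k⟩ over w_k = 1, times the
prompt predecessor of p; outside the prompt only the first data token has one. The last feed-forward
network erases the scratch space and writes the new token (`LayerSpec.emulator_last`).

The gates stay valid at every depth because |euaf| ≤ 1: pair scores are at most dB and the tail
coefficient at most #{w = 1}·dB. As euaf fixes [0,1], data tokens may be activated like all others.
Strong induction on the position gives `generatedToken_emulator`. A given coarse network is encoded
by placing the two factors of each rank-one summand next to each other (`exists_pair_prompt`). -/

/-- A linear functional given by a list of coefficients and coordinates. -/
def lin {b : ℕ} (l : List (ℝ × Fin b)) (v : Fin b → ℝ) : ℝ :=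
  (l.map fun p => p.1 * v p.2).sum

@[simp] theorem lin_nil {b : ℕ} (v : Fin b → ℝ) : lin [] v = 0 := rfl

@[simp] theorem lin_cons {b : ℕ} (p : ℝ × Fin b) (l : List (ℝ × Fin b)) (v : Fin b → ℝ) :
    lin (p :: l) v = p.1 * v p.2 + lin l v := by
  simp [lin]

@[simp] theorem lin_append {b : ℕ} (l l' : List (ℝ × Fin b)) (v : Fin b → ℝ) :
    lin (l ++ l') v = lin l v + lin l' v := by
  simp [lin]

theorem lin_ofFn {b m : ℕ} (c : Fin m → ℝ) (φ : Fin m → Fin b) (v : Fin b → ℝ) :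
    lin (List.ofFn fun r => (c r, φ r)) v = ∑ r, c r * v (φ r) := by
  simp [lin, List.map_ofFn, List.sum_ofFn]

/-- The matrix whose rows are the given sparse linear functionals. -/
def ofRows {a b : ℕ} (f : Fin a → List (ℝ × Fin b)) : Matrix (Fin a) (Fin b) ℝ :=
  fun i j => lin (f i) (Pi.single j 1)

theorem ofRows_mulVec {a b : ℕ} (f : Fin a → List (ℝ × Fin b)) (v : Fin b → ℝ) (i : Fin a) :
    (ofRows f *ᵥ v) i = lin (f i) v := by
  simp only [Matrix.mulVec, dotProduct, ofRows]
  induction f i with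
  | nil => simp
  | cons p l ih =>
    simp only [lin_cons, add_mul, Finset.sum_add_distrib, ih]
    congr 1
    simp [Pi.single_apply]

/-- At most eight entries, each of absolute value at most eight. -/
def SmallRow {b : ℕ} (l : List (ℝ × Fin b)) : Prop :=
  l.length ≤ 8 ∧ ∀ p ∈ l, |p.1| ≤ 8

theorem abs_lin_single_le {b : ℕ} (l : List (ℝ × Fin b)) (j : Fin b)
    (h : ∀ p ∈ l, |p.1| ≤ 8) : |lin l (Pi.single j 1)| ≤ 8 * l.length := by
  induction l with
  | nil => simp
  | cons p l ih =>
    rw [lin_cons]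
    have h1 : |p.1 * (Pi.single j 1 : Fin b → ℝ) p.2| ≤ 8 := by
      have := h p (by simp)
      rcases eq_or_ne p.2 j with e | e
      · simpa [e] using this
      · simp [Pi.single_eq_of_ne e]
    have h2 := ih fun q hq => h q (by simp [hq])
    have h3 := abs_add_le (p.1 * (Pi.single j 1 : Fin b → ℝ) p.2) (lin l (Pi.single j 1))
    push_cast [List.length_cons]
    linarith

/-- A coordinate may occur repeatedly in a row, so up to eight coefficients of size eight can add up
in one entry. -/
theorem entryMax_ofRows_le {a b : ℕ} (f : Fin a → List (ℝ × Fin b))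
    (h : ∀ i, SmallRow (f i)) : entryMax (ofRows f) ≤ 64 := by
  refine Finset.sup_le fun p _ => ?_
  rw [← NNReal.coe_le_coe, coe_nnnorm, Real.norm_eq_abs]
  refine (abs_lin_single_le _ _ (h p.1).2).trans ?_
  have : ((f p.1).length : ℝ) ≤ 8 := by exact_mod_cast (h p.1).1
  push_cast
  linarith

theorem lin_single_eq_zero {b : ℕ} (l : List (ℝ × Fin b)) (j : Fin b)
    (h : j ∉ l.map Prod.snd) : lin l (Pi.single j 1) = 0 := by
  induction l with
  | nil => rfl
  | cons p l ih =>
    simp only [List.map_cons, List.mem_cons, not_or] at h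
    rw [lin_cons, ih h.2, Pi.single_eq_of_ne (Ne.symm h.1)]
    simp

theorem entryCount_ofRows_le {a b : ℕ} (f : Fin a → List (ℝ × Fin b))
    (h : ∀ i, SmallRow (f i)) : entryCount (ofRows f) ≤ 8 * a := by
  classical
  let s : Finset (Fin a × Fin b) :=
    Finset.univ.biUnion fun i => (((f i).map Prod.snd).toFinset).image fun j => (i, j)
  have hs : {p : Fin a × Fin b | ofRows f p.1 p.2 ≠ 0} ⊆ (s : Set (Fin a × Fin b)) := by
    rintro ⟨i, j⟩ hij
    by_contra hns
    refine hij (lin_single_eq_zero _ _ fun hj => hns ?_)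
    simp only [s, Finset.coe_biUnion, Set.mem_iUnion]
    refine ⟨i, by simp, ?_⟩
    simp only [Finset.coe_image, Set.mem_image]
    exact ⟨j, by simpa using hj, rfl⟩
  calc entryCount (ofRows f) ≤ (s : Set (Fin a × Fin b)).ncard :=
        Set.ncard_le_ncard hs (Finset.finite_toSet s)
    _ = s.card := Set.ncard_coe_finset s
    _ ≤ ∑ _i : Fin a, 8 := by
        refine Finset.card_biUnion_le.trans (Finset.sum_le_sum fun i _ => ?_)
        refine Finset.card_image_le.trans ((List.toFinset_card_le _).trans ?_)
        simpa using (h i).1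
    _ = 8 * a := by simp [mul_comm]

/-! ### Coordinates of a token -/

/-- The `i`-th coordinate of the vector slot `s`. -/
def vx {d : ℕ} (s : Fin 4) (i : Fin d) : Fin (4 * d + 8) :=
  finSumFinEquiv (.inl (finProdFinEquiv (s, i)))

/-- The scalar slot `a`. -/
def sx {d : ℕ} (a : Fin 8) : Fin (4 * d + 8) := finSumFinEquiv (.inr a)

/-- The family with the given entries in the vector slots and in the scalar slots. -/
def slots {d : ℕ} {α : Type*} (v : Fin 4 → Fin d → α) (s : Fin 8 → α) (k : Fin (4 * d + 8)) : α :=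
  Sum.elim (fun p => v (finProdFinEquiv.symm p).1 (finProdFinEquiv.symm p).2) s
    (finSumFinEquiv.symm k)

@[simp] theorem slots_vx {d : ℕ} {α : Type*} (v : Fin 4 → Fin d → α) (s : Fin 8 → α)
    (a : Fin 4) (i : Fin d) : slots v s (vx a i) = v a i := by
  rw [slots, vx, Equiv.symm_apply_apply, Sum.elim_inl, Equiv.symm_apply_apply]

@[simp] theorem slots_sx {d : ℕ} {α : Type*} (v : Fin 4 → Fin d → α) (s : Fin 8 → α)
    (a : Fin 8) : slots v s (sx a) = s a := by
  simp [slots, sx]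

theorem forall_coord {d : ℕ} {P : Fin (4 * d + 8) → Prop} :
    (∀ k, P k) ↔ (∀ a i, P (vx a i)) ∧ ∀ a, P (sx a) := by
  refine ⟨fun h => ⟨fun a i => h _, fun a => h _⟩, fun h k => ?_⟩
  obtain ⟨q, rfl⟩ := finSumFinEquiv.surjective k
  rcases q with q | q
  · obtain ⟨p, rfl⟩ := finProdFinEquiv.surjective q
    exact h.1 p.1 p.2
  · exact h.2 q

theorem coord_ext {d : ℕ} {α : Type*} {f g : Fin (4 * d + 8) → α}
    (hv : ∀ a i, f (vx a i) = g (vx a i)) (hs : ∀ a, f (sx a) = g (sx a)) : f = g :=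
  funext (forall_coord.2 ⟨hv, hs⟩)

theorem sum_coord {d : ℕ} (F : Fin (4 * d + 8) → ℝ) :
    ∑ k, F k = ∑ a, ∑ i, F (vx a i) + ∑ a, F (sx a) := by
  rw [← finSumFinEquiv.sum_comp, Fintype.sum_sum_type, ← finProdFinEquiv.sum_comp,
    Fintype.sum_prod_type]
  rfl

theorem vx_val {d : ℕ} (s : Fin 4) (i : Fin d) : (vx s i : ℕ) = i + d * s := rfl

theorem sx_val {d : ℕ} (a : Fin 8) : (sx (d := d) a : ℕ) = 4 * d + a := rfl

theorem token_eq_slots {d : ℕ} (x : Fin d → ℝ) (w : ℤ) (j : ℕ) (S : ℝ) :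
    token x w j S = slots ![x, 0, 0, 0] ![0, 0, 0, 0, 1, S, S * w, S * j] := by
  apply coord_ext
  · intro a i
    have hi := i.isLt
    have hv := vx_val a i
    rw [slots_vx]
    match a with
    | 0 =>
      have h : (vx 0 i : ℕ) = i := by simpa using hv
      simp [token, h]
    | 1 | 2 | 3 =>
      simp only [Fin.coe_ofNat_eq_mod] at hv
      rw [token, dif_neg (by omega), if_neg (by omega), if_neg (by omega), if_neg (by omega),
        if_neg (by omega)]
      rfl
  · intro a
    rw [slots_sx]
    fin_cases a <;> simp [token, sx_val] <;> (intro h; omega)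

/-! ### Gated attention layers with coordinatewise feed-forward networks -/

/-- For integral `τ / S` and `|a| ≤ S` this is `a` if `τ = 0` and `0` otherwise. -/
def gate (a S τ : ℝ) : ℝ :=
  relu (a + (2 * τ + S)) - relu (2 * τ + S) - relu (a + (2 * τ - S)) + relu (2 * τ - S)

/-- The thresholds 2St ± S have absolute value at least S ≥ |a|, so no ReLU pair is cut in the
middle. For t > 0 both pairs give a and cancel, for t < 0 both give 0, and for t = 0 only the first
gives a. -/
theorem gate_int {a S : ℝ} (t : ℤ) (ha : |a| ≤ S) : gate a S (S * t) = if t = 0 then a else 0 := by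
  obtain ⟨h1, h2⟩ := abs_le.1 ha
  have hS : 0 ≤ S := (abs_nonneg a).trans ha
  unfold gate relu
  rcases lt_trichotomy t 0 with h | h | h
  · have ht : (t : ℝ) ≤ -1 := by exact_mod_cast (by omega : t ≤ -1)
    have : S * t ≤ S * (-1) := mul_le_mul_of_nonneg_left ht hS
    rw [if_neg h.ne, max_eq_left (by linarith), max_eq_left (by linarith),
      max_eq_left (by linarith), max_eq_left (by linarith)]
    ring
  · subst h
    simp only [Int.cast_zero, mul_zero, zero_add, if_true]
    rw [max_eq_right (by linarith), max_eq_right (by linarith),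
      max_eq_left (by linarith), max_eq_left (by linarith)]
    ring
  · have ht : (1 : ℝ) ≤ t := by exact_mod_cast (by omega : 1 ≤ t)
    have : S * 1 ≤ S * t := mul_le_mul_of_nonneg_left ht hS
    rw [if_neg h.ne', max_eq_right (by linarith), max_eq_right (by linarith),
      max_eq_right (by linarith), max_eq_right (by linarith)]
    ring

/-- Data of a layer: the content `a` of its gate is a scalar of the query (`some`) or the inner
product of slot `2` of the query with slot `0` of the key (`none`); the offset of the gate is the
sum of the functional `f` of the query and `g` of the key; `V σ` are the rows of the value matrix
times `σ`; each output coordinate of the feed-forward network has a list of hidden units, given by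
an outer coefficient and an inner functional. -/
structure LayerSpec (d : ℕ) where
  content : Option (Fin 8)
  f : List (ℝ × Fin (4 * d + 8))
  g : List (ℝ × Fin (4 * d + 8))
  V : ℝ → Fin (4 * d + 8) → List (ℝ × Fin (4 * d + 8))
  units : Fin (4 * d + 8) → List (ℝ × List (ℝ × Fin (4 * d + 8)))

namespace LayerSpec

variable {d : ℕ}

/-- Query matrix: content with the factor `ε`, offset shifted by `s`. -/
def queryRows (θ : LayerSpec d) (ε s : ℝ) : Fin (4 * d + 8) → List (ℝ × Fin (4 * d + 8)) :=
  slots ![fun i => if θ.content = none then [(ε, vx 2 i)] else [], fun _ => [], fun _ => [],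
      fun _ => []]
    ![(θ.content.map fun a => (ε, sx a)).toList, (s, sx 5) :: θ.f ++ θ.f, [(1, sx 4)],
      [], [], [], [], []]

/-- Key matrix. -/
def keyRows (θ : LayerSpec d) : Fin (4 * d + 8) → List (ℝ × Fin (4 * d + 8)) :=
  slots ![fun i => [(1, vx 0 i)], fun _ => [], fun _ => [], fun _ => []]
    ![[(1, sx 4)], [(1, sx 4)], θ.g ++ θ.g, [], [], [], [], []]

/-- Number `r` of the hidden units of the coordinate `o`. -/
def unit (θ : LayerSpec d) (o : Fin (4 * d + 8)) (r : Fin 5) :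
    ℝ × List (ℝ × Fin (4 * d + 8)) :=
  (θ.units o).getD r (0, [])

/-- The transformer layer with the given data. -/
def toLayer (θ : LayerSpec d) : TFLayer (4 * d + 8) where
  heads := 4
  Q := ![ofRows (θ.queryRows 1 1), ofRows (θ.queryRows 0 1), ofRows (θ.queryRows 1 (-1)),
    ofRows (θ.queryRows 0 (-1))]
  K := fun _ => ofRows θ.keyRows
  V := ![ofRows (θ.V 1), ofRows (θ.V (-1)), ofRows (θ.V (-1)), ofRows (θ.V 1)]
  width := (4 * d + 8) * 5
  W₁ := ofRows fun h => (θ.unit (finProdFinEquiv.symm h).1 (finProdFinEquiv.symm h).2).2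
  W₂ := ofRows fun o => List.ofFn fun r : Fin 5 => ((θ.unit o r).1, finProdFinEquiv (o, r))

/-- The content of the gate. -/
def contentVal (θ : LayerSpec d) (h h' : Fin (4 * d + 8) → ℝ) : ℝ :=
  match θ.content with
  | none => ∑ i, h (vx 2 i) * h' (vx 0 i)
  | some a => h (sx a)

/-- The constant coordinate turns sums into inner products: separate scalar coordinates of query and
key carry a scalar content, the offset of the query and that of the key. Listing `f` and `g` twice
supplies the factor 2 in `gate`. -/
theorem score_eq (θ : LayerSpec d) (ε s : ℝ) (h h' : Fin (4 * d + 8) → ℝ)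
    (h1 : h (sx 4) = 1) (h1' : h' (sx 4) = 1) :
    (ofRows (θ.queryRows ε s) *ᵥ h) ⬝ᵥ (ofRows θ.keyRows *ᵥ h') =
      ε * θ.contentVal h h' + (2 * (lin θ.f h + lin θ.g h') + s * h (sx 5)) := by
  rw [dotProduct, sum_coord]
  simp only [ofRows_mulVec, Fin.sum_univ_four, Fin.sum_univ_eight, queryRows, keyRows, slots_vx,
    slots_sx]
  rcases hc : θ.content with _ | a
  · simp [contentVal, hc, h1, h1', Finset.mul_sum, mul_assoc]
    ring
  · simp [contentVal, hc, h1, h1']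
    ring

/-- Conditions under which the matrices of the layer are sparse and bounded and act as described. -/
structure Small (θ : LayerSpec d) : Prop where
  f_length : θ.f.length ≤ 3
  f_le : ∀ p ∈ θ.f, |p.1| ≤ 8
  g_length : θ.g.length ≤ 3
  g_le : ∀ p ∈ θ.g, |p.1| ≤ 8
  V_one : ∀ o, SmallRow (θ.V 1 o)
  V_neg : ∀ o, SmallRow (θ.V (-1) o)
  V_lin : ∀ v o, lin (θ.V (-1) o) v = -lin (θ.V 1 o) v
  units_length : ∀ o, (θ.units o).length ≤ 5
  units_row : ∀ o, ∀ u ∈ θ.units o, |u.1| ≤ 8 ∧ SmallRow u.2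

theorem attn_apply (θ : LayerSpec d) {n : ℕ} (H : Fin n → Fin (4 * d + 8) → ℝ)
    (hθ : θ.Small) (h1 : ∀ k, H k (sx 4) = 1)
    (j : Fin n) (o : Fin (4 * d + 8)) :
    θ.toLayer.attn H j o = H j o + ∑ k, gate (θ.contentVal (H j) (H k)) (H j (sx 5))
      (lin θ.f (H j) + lin θ.g (H k)) * lin (θ.V 1 o) (H k) := by
  simp only [TFLayer.attn, Pi.add_apply, Finset.sum_apply, Pi.smul_apply, smul_eq_mul]
  congr 1
  change ∑ m : Fin 4, _ = _
  rw [Finset.sum_comm]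
  refine Finset.sum_congr rfl fun k _ => ?_
  simp only [Fin.sum_univ_four, toLayer, Matrix.cons_val, ofRows_mulVec, hθ.V_lin,
    score_eq θ _ _ _ _ (h1 j) (h1 k), gate, one_mul, zero_mul, zero_add, neg_one_mul,
    ← sub_eq_add_neg]
  ring

/-- Missing hidden units are padded with outer coefficient 0, so they are harmless for any
activation. -/
theorem sum_unit (l : List (ℝ × List (ℝ × Fin (4 * d + 8)))) (hl : l.length ≤ 5)
    (σ : List (ℝ × Fin (4 * d + 8)) → ℝ) :
    ∑ r : Fin 5, (l.getD r (0, [])).1 * σ (l.getD r (0, [])).2 =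
      (l.map fun u => u.1 * σ u.2).sum := by
  rw [Fin.sum_univ_five]
  match l, hl with
  | [], _ => simp
  | [a], _ => simp
  | [a, b], _ => simp
  | [a, b, c], _ => simp [add_assoc]
  | [a, b, c, e], _ => simp [add_assoc]
  | [a, b, c, e, f], _ => simp [add_assoc]

theorem ffn_apply (θ : LayerSpec d) (σ : ℝ → ℝ) {n : ℕ} (H : Fin n → Fin (4 * d + 8) → ℝ)
    (hθ : θ.Small) (j : Fin n) (o : Fin (4 * d + 8)) :
    θ.toLayer.ffn σ H j o = H j o + ((θ.units o).map fun u => u.1 * σ (lin u.2 (H j))).sum := by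
  rw [← sum_unit (θ.units o) (hθ.units_length o) fun l => σ (lin l (H j))]
  simp only [TFLayer.ffn, Pi.add_apply]
  congr 1
  refine (ofRows_mulVec _ _ _).trans ?_
  refine (lin_ofFn _ _ _).trans (Finset.sum_congr rfl fun r _ => ?_)
  have h : (θ.toLayer.W₁ *ᵥ H j) (finProdFinEquiv (o, r)) = lin (θ.unit o r).2 (H j) := by
    refine (ofRows_mulVec _ _ _).trans ?_
    rw [Equiv.symm_apply_apply]
  exact congrArg (fun y => (θ.unit o r).1 * σ y) h

/-! ### Sparsity and size of a single layer -/

namespace Small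

variable {θ : LayerSpec d}

theorem queryRows_small (h : θ.Small) {ε s : ℝ} (hε : |ε| ≤ 8) (hs : |s| ≤ 8) :
    ∀ k, SmallRow (θ.queryRows ε s k) := by
  have h1 := h.f_length
  have h2 := h.f_le
  refine forall_coord.2 ⟨fun a i => ?_, fun a => ?_⟩
  · rw [queryRows, slots_vx]
    fin_cases a <;> simp [SmallRow]
    split_ifs <;> simp [hε]
  · rw [queryRows, slots_sx]
    fin_cases a <;> simp [SmallRow]
    · cases θ.content <;> simp [hε]
    · refine ⟨by omega, hs, ?_⟩
      exact fun a b hab => h2 (a, b) hab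

theorem keyRows_small (h : θ.Small) : ∀ k, SmallRow (θ.keyRows k) := by
  have h1 := h.g_length
  have h2 := h.g_le
  refine forall_coord.2 ⟨fun a i => ?_, fun a => ?_⟩
  · rw [keyRows, slots_vx]
    fin_cases a <;> simp [SmallRow]
  · rw [keyRows, slots_sx]
    fin_cases a <;> simp [SmallRow]
    refine ⟨by omega, fun a b hab => h2 (a, b) hab⟩

theorem unit_small (h : θ.Small) (o : Fin (4 * d + 8)) (r : Fin 5) :
    |(θ.unit o r).1| ≤ 8 ∧ SmallRow (θ.unit o r).2 := by
  rw [unit]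
  by_cases hr : (r : ℕ) < (θ.units o).length
  · rw [List.getD_eq_getElem _ _ hr]
    exact h.units_row o _ (List.getElem_mem hr)
  · rw [List.getD_eq_default _ _ (not_lt.1 hr)]
    simp [SmallRow]

theorem W₁_small (h : θ.Small) (k : Fin ((4 * d + 8) * 5)) :
    SmallRow (θ.unit (finProdFinEquiv.symm k).1 (finProdFinEquiv.symm k).2).2 :=
  (h.unit_small _ _).2

theorem W₂_small (h : θ.Small) (o : Fin (4 * d + 8)) :
    SmallRow (List.ofFn fun r : Fin 5 => ((θ.unit o r).1, finProdFinEquiv (o, r))) := by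
  refine ⟨by simp, fun p hp => ?_⟩
  obtain ⟨r, rfl⟩ := (List.mem_ofFn' _ _).1 hp
  exact (h.unit_small o r).1

theorem Q_small (h : θ.Small) (m : Fin 4) :
    entryMax (θ.toLayer.Q m) ≤ 64 ∧ entryCount (θ.toLayer.Q m) ≤ 8 * (4 * d + 8) := by
  fin_cases m <;>
  exact ⟨entryMax_ofRows_le _ (h.queryRows_small (by norm_num) (by norm_num)),
    entryCount_ofRows_le _ (h.queryRows_small (by norm_num) (by norm_num))⟩

theorem V_small (h : θ.Small) (m : Fin 4) :
    entryMax (θ.toLayer.V m) ≤ 64 ∧ entryCount (θ.toLayer.V m) ≤ 8 * (4 * d + 8) := by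
  fin_cases m
  exacts [⟨entryMax_ofRows_le _ h.V_one, entryCount_ofRows_le _ h.V_one⟩,
    ⟨entryMax_ofRows_le _ h.V_neg, entryCount_ofRows_le _ h.V_neg⟩,
    ⟨entryMax_ofRows_le _ h.V_neg, entryCount_ofRows_le _ h.V_neg⟩,
    ⟨entryMax_ofRows_le _ h.V_one, entryCount_ofRows_le _ h.V_one⟩]

theorem max_le (h : θ.Small) :
    (entryMax θ.toLayer.W₁ ⊔ entryMax θ.toLayer.W₂ ⊔
      Finset.univ.sup fun m : Fin θ.toLayer.heads =>
        entryMax (θ.toLayer.Q m) ⊔ entryMax (θ.toLayer.K m) ⊔ entryMax (θ.toLayer.V m)) ≤ 64 :=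
  sup_le (sup_le (entryMax_ofRows_le _ h.W₁_small) (entryMax_ofRows_le _ h.W₂_small))
    (Finset.sup_le fun m _ => sup_le (sup_le (h.Q_small m).1
      (entryMax_ofRows_le _ h.keyRows_small)) (h.V_small m).1)

/-- In multiples of 4d + 8: 40 for `W₁` (five hidden units per coordinate), 8 for `W₂` and 24 for
each of the four heads. -/
theorem count_le (h : θ.Small) :
    entryCount θ.toLayer.W₁ + entryCount θ.toLayer.W₂ +
      ∑ m : Fin θ.toLayer.heads, (entryCount (θ.toLayer.Q m) + entryCount (θ.toLayer.K m) +
        entryCount (θ.toLayer.V m)) ≤ 144 * (4 * d + 8) := by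
  have h1 : entryCount θ.toLayer.W₁ ≤ 8 * ((4 * d + 8) * 5) := entryCount_ofRows_le _ h.W₁_small
  have h2 : entryCount θ.toLayer.W₂ ≤ 8 * (4 * d + 8) := entryCount_ofRows_le _ h.W₂_small
  have h3 : ∑ m : Fin θ.toLayer.heads, (entryCount (θ.toLayer.Q m) + entryCount (θ.toLayer.K m) +
        entryCount (θ.toLayer.V m)) ≤ ∑ _m : Fin 4, 24 * (4 * d + 8) := by
    refine Finset.sum_le_sum fun m _ => ?_
    have hQ := (h.Q_small m).2
    have hK : entryCount (θ.toLayer.K m) ≤ 8 * (4 * d + 8) :=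
      entryCount_ofRows_le _ h.keyRows_small
    have hV := (h.V_small m).2
    omega
  rw [Finset.sum_const, Finset.card_univ, Fintype.card_fin, smul_eq_mul] at h3
  omega

end Small

theorem paramMax_le (Θ : List (LayerSpec d)) (h : ∀ θ ∈ Θ, θ.Small) :
    paramMax (Θ.map toLayer) ≤ 64 := by
  induction Θ with
  | nil => simp [paramMax]
  | cons θ Θ ih =>
    exact max_le (h θ (by simp)).max_le (ih fun θ' h' => h θ' (by simp [h']))

theorem paramCount_le (Θ : List (LayerSpec d)) (h : ∀ θ ∈ Θ, θ.Small) :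
    paramCount (Θ.map toLayer) ≤ Θ.length * (144 * (4 * d + 8)) := by
  induction Θ with
  | nil => simp [paramCount]
  | cons θ Θ ih =>
    have h1 := (h θ (by simp)).count_le
    have h2 := ih fun θ' h' => h θ' (by simp [h'])
    refine (add_le_add h1 h2).trans (le_of_eq ?_)
    rw [List.length_cons]
    ring

end LayerSpec

/-! ### The layers of the emulator -/

namespace LayerSpec

variable {d : ℕ}

/-- Counts the data tokens into scalar slot `0` and applies `euaf` into vector slot `1`. -/
def countLayer (d : ℕ) : LayerSpec d where
  content := some 5
  f := []
  g := [(1, sx 6)]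
  V := fun σ => slots ![fun _ => [], fun _ => [], fun _ => [], fun _ => []]
    ![[(σ, sx 4)], [], [], [], [], [], [], []]
  units := slots ![fun _ => [], fun i => [(1, [(1, vx 0 i)])], fun _ => [], fun _ => []]
    ![[], [], [], [], [], [], [], []]

/-- Copies the activated embedding and the layer index of the token to be processed next into
vector slot `2` and scalar slot `1`, and marks the tokens outside the prompt. -/
def targetLayer (d : ℕ) : LayerSpec d where
  content := some 4
  f := [(-1, sx 7), (-1, sx 5), (1, sx 0)]
  g := [(1, sx 7)]
  V := fun σ => slots ![fun _ => [], fun _ => [], fun i => [(σ, vx 1 i)], fun _ => []]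
    ![[], [(σ, sx 6)], [], [], [], [], [], []]
  units := slots
    ![fun _ => [], fun i => [(-1, [(1, vx 1 i)]), (1, [(-1, vx 1 i)])], fun _ => [], fun _ => []]
    ![[], [], [], [(1, [(1, sx 5), (-1, sx 6)]), (-1, [(-1, sx 6)])], [], [], [], []]

/-- Copies the preceding token, if it belongs to the prompt, into vector slot `3` and scalar
slot `2`, and replaces the mark by the indicator of the prompt. -/
def predLayer (d : ℕ) : LayerSpec d where
  content := some 4
  f := [(-2, sx 7), (2, sx 5)]
  g := [(2, sx 7), (1, sx 3)]
  V := fun σ => slots ![fun _ => [], fun _ => [], fun _ => [], fun i => [(σ, vx 0 i)]]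
    ![[], [], [(σ, sx 6)], [], [], [], [], []]
  units := slots ![fun _ => [], fun _ => [], fun _ => [], fun _ => []]
    ![[], [], [], [(-1, [(1, sx 3)]), (1, [(1, sx 6)]), (-1, [(1, sx 6), (-1, sx 4)])],
      [], [], [], []]

/-- Computes the coefficient of the tail term into scalar slot `3`, and adds to the layer index
and stores in scalar slot `2` labels that detect pairs of consecutive tokens. -/
def coeffLayer (d : ℕ) : LayerSpec d where
  content := none
  f := [(-1, sx 5)]
  g := [(1, sx 6)]
  V := fun σ => slots ![fun _ => [], fun _ => [], fun _ => [], fun _ => []]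
    ![[], [], [], [(σ, sx 3)], [], [], [], []]
  units := slots ![fun _ => [], fun _ => [], fun _ => [], fun _ => []]
    ![[], [], [(-1, [(1, sx 2)]),
        (1, [(1, sx 2), (-1, sx 6), (-1, sx 5)]), (1, [(-1, sx 2), (1, sx 6), (1, sx 5)]),
        (-1, [(1, sx 2), (-1, sx 6), (-2, sx 5)]), (-1, [(-1, sx 2), (1, sx 6)])],
      [], [], [],
      [(1 / 2, [(1, sx 6), (-1, sx 2), (-1, sx 5)]), (1 / 2, [(-1, sx 6), (1, sx 2), (1, sx 5)]),
        (-1 / 2, [(1, sx 6), (-1, sx 2), (-2, sx 5)]), (-1 / 2, [(-1, sx 6), (1, sx 2)])],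
      []]

/-- Adds the tail term to vector slot `1`. -/
def tailLayer (d : ℕ) : LayerSpec d where
  content := some 3
  f := [(-2, sx 7), (-2, sx 5), (2, sx 0)]
  g := [(2, sx 7), (1, sx 2)]
  V := fun σ => slots ![fun _ => [], fun i => [(σ, vx 3 i)], fun _ => [], fun _ => []]
    ![[], [], [], [], [], [], [], []]
  units := slots ![fun _ => [], fun _ => [], fun _ => [], fun _ => []]
    ![[], [], [], [], [], [], [], []]

/-- Adds the sum over the pairs of prompt tokens to vector slot `1`, and writes the next token. -/
def pairLayer (d : ℕ) : LayerSpec d where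
  content := none
  f := [(-4, sx 5), (4, sx 1)]
  g := [(2, sx 6)]
  V := fun σ => slots ![fun _ => [], fun i => [(σ, vx 3 i)], fun _ => [], fun _ => []]
    ![[], [], [], [], [], [], [], []]
  units := slots
    ![fun i => [(1, [(1, vx 1 i), (-1, vx 0 i)]), (-1, [(-1, vx 1 i), (1, vx 0 i)])],
      fun i => [(-1, [(1, vx 1 i)]), (1, [(-1, vx 1 i)])],
      fun i => [(-1, [(1, vx 2 i)]), (1, [(-1, vx 2 i)])],
      fun i => [(-1, [(1, vx 3 i)]), (1, [(-1, vx 3 i)])]]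
    ![[(-1, [(1, sx 0)]), (1, [(-1, sx 0)])], [(-1, [(1, sx 1)]), (1, [(-1, sx 1)])],
      [(-1, [(1, sx 2)]), (1, [(-1, sx 2)])], [(-1, [(1, sx 3)]), (1, [(-1, sx 3)])], [], [],
      [(1, [(1, sx 1), (-1, sx 5), (-1, sx 6)]), (-1, [(-1, sx 1), (1, sx 5), (1, sx 6)])],
      [(1, [(1, sx 5)])]]

/-- The layer with zero parameters. -/
def idLayer (d : ℕ) : LayerSpec d where
  content := none
  f := []
  g := []
  V := fun _ _ => []
  units := fun _ => []

/-- The list of the layers of the emulator. -/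
def emulator (d : ℕ) : List (LayerSpec d) :=
  [countLayer d, targetLayer d, predLayer d, coeffLayer d, tailLayer d, pairLayer d, idLayer d,
    idLayer d]

/-! ### Sparsity of the concrete layers -/

theorem countLayer_small : (countLayer d).Small := by
  constructor
  case f_length | f_le | g_length | g_le => norm_num [countLayer]
  case V_lin =>
    intro v
    refine forall_coord.2 ⟨fun a i => ?_, fun a => ?_⟩ <;> fin_cases a <;> simp [countLayer]
  all_goals
    refine forall_coord.2 ⟨fun a i => ?_, fun a => ?_⟩ <;> fin_cases a <;>
      norm_num [countLayer, SmallRow, abs_le, -Prod.forall, -List.mem_cons,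
        List.forall_mem_cons]

theorem targetLayer_small : (targetLayer d).Small := by
  constructor
  case f_length | f_le | g_length | g_le => norm_num [targetLayer]
  case V_lin =>
    intro v
    refine forall_coord.2 ⟨fun a i => ?_, fun a => ?_⟩ <;> fin_cases a <;> simp [targetLayer]
  all_goals
    refine forall_coord.2 ⟨fun a i => ?_, fun a => ?_⟩ <;> fin_cases a <;>
      norm_num [targetLayer, SmallRow, abs_le, -Prod.forall, -List.mem_cons,
        List.forall_mem_cons]

theorem predLayer_small : (predLayer d).Small := by
  constructor
  case f_length | f_le | g_length | g_le => norm_num [predLayer]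
  case V_lin =>
    intro v
    refine forall_coord.2 ⟨fun a i => ?_, fun a => ?_⟩ <;> fin_cases a <;> simp [predLayer]
  all_goals
    refine forall_coord.2 ⟨fun a i => ?_, fun a => ?_⟩ <;> fin_cases a <;>
      norm_num [predLayer, SmallRow, abs_le, -Prod.forall, -List.mem_cons,
        List.forall_mem_cons]

theorem coeffLayer_small : (coeffLayer d).Small := by
  constructor
  case f_length | f_le | g_length | g_le => norm_num [coeffLayer]
  case V_lin =>
    intro v
    refine forall_coord.2 ⟨fun a i => ?_, fun a => ?_⟩ <;> fin_cases a <;> simp [coeffLayer]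
  all_goals
    refine forall_coord.2 ⟨fun a i => ?_, fun a => ?_⟩ <;> fin_cases a <;>
      norm_num [coeffLayer, SmallRow, abs_le, -Prod.forall, -List.mem_cons,
        List.forall_mem_cons]

theorem tailLayer_small : (tailLayer d).Small := by
  constructor
  case f_length | f_le | g_length | g_le => norm_num [tailLayer]
  case V_lin =>
    intro v
    refine forall_coord.2 ⟨fun a i => ?_, fun a => ?_⟩ <;> fin_cases a <;> simp [tailLayer]
  all_goals
    refine forall_coord.2 ⟨fun a i => ?_, fun a => ?_⟩ <;> fin_cases a <;>
      norm_num [tailLayer, SmallRow, abs_le, -Prod.forall, -List.mem_cons,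
        List.forall_mem_cons]

theorem pairLayer_small : (pairLayer d).Small := by
  constructor
  case f_length | f_le | g_length | g_le => norm_num [pairLayer]
  case V_lin =>
    intro v
    refine forall_coord.2 ⟨fun a i => ?_, fun a => ?_⟩ <;> fin_cases a <;> simp [pairLayer]
  all_goals
    refine forall_coord.2 ⟨fun a i => ?_, fun a => ?_⟩ <;> fin_cases a <;>
      norm_num [pairLayer, SmallRow, abs_le, -Prod.forall, -List.mem_cons,
        List.forall_mem_cons]

theorem idLayer_small : (idLayer d).Small := by
  constructor <;> simp [idLayer, SmallRow]

theorem emulator_small : ∀ θ ∈ emulator d, θ.Small := by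
  simp [emulator, countLayer_small, targetLayer_small, predLayer_small, coeffLayer_small,
    tailLayer_small, pairLayer_small, idLayer_small]

theorem idLayer_attn {n : ℕ} (H : Fin n → Fin (4 * d + 8) → ℝ) :
    (idLayer d).toLayer.attn H = H := by
  funext j
  have h : ∀ m k, (idLayer d).toLayer.V m *ᵥ H k = 0 := by
    intro m k
    change Fin 4 at m
    fin_cases m <;> exact funext fun o => ofRows_mulVec _ _ _
  simp [TFLayer.attn, h]

theorem idLayer_ffn {n : ℕ} (σ : ℝ → ℝ) (H : Fin n → Fin (4 * d + 8) → ℝ) :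
    (idLayer d).toLayer.ffn σ H = H := by
  funext j o
  rw [ffn_apply _ _ _ idLayer_small]
  simp [idLayer]

/-! ### The states between the layers -/

/-- The content has to be bounded only at keys with nonzero value; tokens with uncontrolled scores
are silenced in this way. -/
theorem sum_gate {n : ℕ} {S : ℝ} (a τ v : Fin n → ℝ) (t : Fin n → ℤ)
    (hτ : ∀ k, τ k = S * t k) (ha : ∀ k, v k ≠ 0 → |a k| ≤ S) :
    ∑ k, gate (a k) S (τ k) * v k = ∑ k, if t k = 0 then a k * v k else 0 := by
  refine Finset.sum_congr rfl fun k _ => ?_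
  by_cases h : v k = 0
  · simp [h]
  · rw [hτ, gate_int _ (ha k h), ite_mul, zero_mul]

variable {n : ℕ} (x : Fin n → Fin d → ℝ) (w : Fin n → ℤ) (S : ℝ) (N : ℕ)

/-- The activated embedding of the token `N - 1` places before token `k`. -/
def targetVec (k : Fin n) (i : Fin d) : ℝ :=
  ∑ j : Fin n, if (j : ℕ) + N = k + 1 then euaf (x j i) else 0

/-- The layer index of the token `N - 1` places before token `k`. -/
def targetIdx (k : Fin n) : ℤ := ∑ j : Fin n, if (j : ℕ) + N = k + 1 then w j else 0

/-- The embedding of the token before `k`, if that token belongs to the prompt. -/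
def predVec (k : Fin n) (i : Fin d) : ℝ :=
  ∑ j : Fin n, if (j : ℕ) + 1 = k ∧ 1 ≤ w j then x j i else 0

/-- The layer index of the token before `k`, if that token belongs to the prompt. -/
def predIdx (k : Fin n) : ℤ := ∑ j : Fin n, if (j : ℕ) + 1 = k ∧ 1 ≤ w j then w j else 0

variable {S}

/-- The content of the gate is S itself, so each token of index 0 contributes exactly S. -/
theorem count_step (hS : 1 ≤ S) (hN : (∑ k, if w k = 0 then 1 else 0) = N) :
    (countLayer d).toLayer.ffn euaf ((countLayer d).toLayer.attn
        fun k => token (x k) (w k) (k + 1) S) =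
      fun k => slots ![x k, fun i => euaf (x k i), 0, 0]
        ![S * N, 0, 0, 0, 1, S, S * w k, S * (k + 1)] := by
  have hsum : ∀ j : Fin n, ∑ k, gate S S (S * w k) = S * N := by
    intro _
    rw [← hN]
    push_cast
    rw [Finset.mul_sum]
    refine Finset.sum_congr rfl fun k _ => ?_
    rw [gate_int _ (abs_of_nonneg (by linarith)).le]
    split_ifs <;> simp
  have hA : ((countLayer d).toLayer.attn fun k => token (x k) (w k) (k + 1) S) =
      fun k => slots ![x k, 0, 0, 0] ![S * N, 0, 0, 0, 1, S, S * w k, S * (k + 1)] := by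
    funext j
    simp only [token_eq_slots]
    apply coord_ext
    · intro a i
      rw [attn_apply _ _ countLayer_small (by simp)]
      fin_cases a <;> simp [countLayer]
    · intro a
      rw [attn_apply _ _ countLayer_small (by simp)]
      fin_cases a <;> simp [countLayer, contentVal, hsum j]
  rw [hA]
  funext j
  apply coord_ext
  · intro a i
    rw [ffn_apply _ _ _ countLayer_small]
    fin_cases a <;> simp [countLayer]
  · intro a
    rw [ffn_apply _ _ _ countLayer_small]
    fin_cases a <;> simp [countLayer]


theorem relu_add_neg_relu_neg (r : ℝ) : relu r + -relu (-r) = r := by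
  unfold relu
  rcases le_total 0 r with h | h
  · rw [max_eq_right h, max_eq_left (by linarith)]; ring
  · rw [max_eq_left h, max_eq_right (by linarith)]; ring

theorem add_neg_relu_add_relu_neg (r : ℝ) : r + (-relu r + relu (-r)) = 0 := by
  linarith [relu_add_neg_relu_neg r]

variable {w N}

theorem target_step (hS : 1 ≤ S) :
    (targetLayer d).toLayer.ffn relu ((targetLayer d).toLayer.attn
        fun k => slots ![x k, fun i => euaf (x k i), 0, 0]
          ![S * N, 0, 0, 0, 1, S, S * w k, S * (k + 1)]) =
      fun k => slots ![x k, 0, targetVec x N k, 0]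
        ![S * N, S * targetIdx w N k, 0, S * if 1 ≤ w k then 0 else 1, 1, S, S * w k,
          S * (k + 1)] := by
  have hg : ∀ (j : Fin n) (v : Fin n → ℝ),
      ∑ k : Fin n, gate 1 S (-(S * (j + 1)) + (-S + S * N) + S * (k + 1)) * v k =
        ∑ k : Fin n, if (k : ℕ) + N = j + 1 then v k else 0 := by
    intro j v
    -- The stored count S N makes the distance to the attended token depend on N, although the
    -- parameters do not.
    rw [sum_gate (fun _ => 1) _ v (fun k => (k + N - (j + 1) : ℤ)) (fun k => by push_cast; ring)
      (fun k _ => by simpa using hS)]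
    refine Finset.sum_congr rfl fun k _ => ?_
    simp only [one_mul]
    exact if_congr (by omega) rfl rfl
  have hA : ((targetLayer d).toLayer.attn fun k => slots ![x k, fun i => euaf (x k i), 0, 0]
          ![S * N, 0, 0, 0, 1, S, S * w k, S * (k + 1)]) =
      fun k => slots ![x k, fun i => euaf (x k i), targetVec x N k, 0]
        ![S * N, S * targetIdx w N k, 0, 0, 1, S, S * w k, S * (k + 1)] := by
    funext j
    apply coord_ext
    · intro a i
      rw [attn_apply _ _ targetLayer_small (by simp)]
      fin_cases a <;> simp [targetLayer, contentVal, hg, targetVec]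
    · intro a
      rw [attn_apply _ _ targetLayer_small (by simp)]
      fin_cases a <;> simp [targetLayer, contentVal, hg, targetIdx, Finset.mul_sum]
  rw [hA]
  funext j
  have h0 : 0 ≤ S := by linarith
  apply coord_ext
  · intro a i
    rw [ffn_apply _ _ _ targetLayer_small]
    fin_cases a <;> simp [targetLayer, add_neg_relu_add_relu_neg]
  · intro a
    rw [ffn_apply _ _ _ targetLayer_small]
    fin_cases a <;> simp [targetLayer]
    split_ifs with h
    -- The mark is relu(S - S w) - relu(-S w): zero for w ≥ 1 and S for w ≤ 0.
    · have : S * 1 ≤ S * w j := mul_le_mul_of_nonneg_left (by exact_mod_cast h) h0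
      rw [relu, relu, max_eq_left (by linarith), max_eq_left (by linarith)]
      simp
    · have : S * w j ≤ S * 0 := mul_le_mul_of_nonneg_left (by exact_mod_cast (by omega)) h0
      rw [relu, relu, max_eq_right (by linarith), max_eq_right (by linarith)]
      ring

theorem pred_step (hS : 1 ≤ S) (y : Fin n → Fin d → ℝ) (t : Fin n → ℝ) :
    (predLayer d).toLayer.ffn relu ((predLayer d).toLayer.attn
        fun k => slots ![x k, 0, y k, 0]
          ![S * N, t k, 0, S * if 1 ≤ w k then 0 else 1, 1, S, S * w k, S * (k + 1)]) =
      fun k => slots ![x k, 0, y k, predVec x w k]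
        ![S * N, t k, S * predIdx w k, if 1 ≤ w k then 1 else 0, 1, S, S * w k,
          S * (k + 1)] := by
  have hg : ∀ (j : Fin n) (v : Fin n → ℝ),
      ∑ k : Fin n, gate 1 S (-(2 * (S * (j + 1))) + 2 * S +
          (2 * (S * (k + 1)) + S * if 1 ≤ w k then 0 else 1)) * v k =
        ∑ k : Fin n, if (k : ℕ) + 1 = j ∧ 1 ≤ w k then v k else 0 := by
    intro j v
    -- Parity: an even number plus a 0/1 mark vanishes only if both do, which tests position and
    -- membership in the prompt at once.
    rw [sum_gate (fun _ => 1) _ v (fun k => (2 * k - 2 * j + 2 + if 1 ≤ w k then 0 else 1 : ℤ))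
      (fun k => by push_cast; ring) (fun k _ => by simpa using hS)]
    refine Finset.sum_congr rfl fun k _ => ?_
    simp only [one_mul]
    refine if_congr ?_ rfl rfl
    split_ifs <;> omega
  have hA : ((predLayer d).toLayer.attn fun k => slots ![x k, 0, y k, 0]
          ![S * N, t k, 0, S * if 1 ≤ w k then 0 else 1, 1, S, S * w k, S * (k + 1)]) =
      fun k => slots ![x k, 0, y k, predVec x w k]
        ![S * N, t k, S * predIdx w k, S * if 1 ≤ w k then 0 else 1, 1, S, S * w k,
          S * (k + 1)] := by
    funext j
    apply coord_ext
    · intro a i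
      rw [attn_apply _ _ predLayer_small (by simp)]
      fin_cases a <;> simp [predLayer, contentVal, hg, predVec, -mul_ite]
    · intro a
      rw [attn_apply _ _ predLayer_small (by simp)]
      fin_cases a <;> simp [predLayer, contentVal, hg, predIdx, Finset.mul_sum, -mul_ite]
      simp
  rw [hA]
  funext j
  have h0 : 0 ≤ S := by linarith
  apply coord_ext
  · intro a i
    rw [ffn_apply _ _ _ predLayer_small]
    fin_cases a <;> simp [predLayer]
  · intro a
    rw [ffn_apply _ _ _ predLayer_small]
    fin_cases a <;> simp [predLayer]
    split_ifs with h
    -- The indicator is relu(S w) - relu(S w - 1); it equals 1 here because S w ≥ S ≥ 1.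
    · have : S * 1 ≤ S * w j := mul_le_mul_of_nonneg_left (by exact_mod_cast h) h0
      simp only [relu]
      rw [max_eq_right (by simp), max_eq_right (by linarith), max_eq_right (by linarith)]
      simp
    · have : S * w j ≤ S * 0 := mul_le_mul_of_nonneg_left (by exact_mod_cast (by omega)) h0
      simp only [relu]
      rw [max_eq_right h0, max_eq_left (by linarith), max_eq_left (by linarith)]
      simp

theorem predIdx_nonneg (k : Fin n) : 0 ≤ predIdx w k :=
  Finset.sum_nonneg fun j _ => by split_ifs <;> omega

/-- Four ReLU units that detect whether an integer vanishes. -/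
theorem relu_detect (h0 : 0 ≤ S) (m : ℤ) :
    relu (S * m) + relu (-(S * m)) - relu (S * m - S) - relu (-(S * m) - S) =
      S * if m = 0 then 0 else 1 := by
  unfold relu
  rcases lt_trichotomy m 0 with h | h | h
  · have : S * m ≤ S * (-1) :=
      mul_le_mul_of_nonneg_left (by exact_mod_cast (by omega : m ≤ -1)) h0
    rw [if_neg h.ne, max_eq_left (by linarith), max_eq_right (by linarith),
      max_eq_left (by linarith), max_eq_right (by linarith)]
    ring
  · simp [h, h0]
  · have : S * 1 ≤ S * m :=
      mul_le_mul_of_nonneg_left (by exact_mod_cast (by omega : 1 ≤ m)) h0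
    rw [if_neg h.ne', max_eq_right (by linarith), max_eq_left (by linarith),
      max_eq_right (by linarith), max_eq_left (by linarith)]
    ring

/-- Coefficient of the tail term, as computed by token `k`. -/
def tailCoeff (x : Fin n → Fin d → ℝ) (w : Fin n → ℤ) (y : Fin d → ℝ) : ℝ :=
  ∑ j, if w j = 1 then ∑ i, y i * x j i else 0

/-- The coefficient is existentially quantified because scores of other query tokens may exceed S;
it is identified only where the bounds hold. The values are prompt indicators, so only prompt keys
need a bound, and `w k ≤ 0` makes the slot start from 0. The labels prepare later parity tests; the
one added to the index is S/2 because `pairLayer` doubles that slot. -/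
theorem coeff_step (hS : 1 ≤ S) (y p : Fin n → Fin d → ℝ) (t : Fin n → ℝ) (q : Fin n → ℤ)
    (hq : ∀ k, 0 ≤ q k) :
    ∃ c : Fin n → ℝ,
      (∀ k, w k ≤ 0 → (∀ j, 1 ≤ w j → |∑ i, y k i * x j i| ≤ S) → c k = tailCoeff x w (y k)) ∧
      (coeffLayer d).toLayer.ffn relu ((coeffLayer d).toLayer.attn
        fun k => slots ![x k, 0, y k, p k]
          ![S * N, t k, S * q k, if 1 ≤ w k then 1 else 0, 1, S, S * w k, S * (k + 1)]) =
      fun k => slots ![x k, 0, y k, p k]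
        ![S * N, t k, S * if q k = w k + 1 then 0 else 1, c k, 1, S,
          S * w k + S / 2 * if w k = q k + 1 then 0 else 1, S * (k + 1)] := by
  refine ⟨fun k => (if 1 ≤ w k then 1 else 0) + ∑ j, gate (∑ i, y k i * x j i) S
    (-S + S * w j) * if 1 ≤ w j then 1 else 0, fun k hk hb => ?_, ?_⟩
  · beta_reduce
    rw [if_neg (by omega), zero_add, sum_gate _ _ _ (fun j => w j - 1)
      (fun j => by push_cast; ring) (fun j hj => hb j (by by_contra h; simp [h] at hj))]
    refine Finset.sum_congr rfl fun j _ => ?_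
    by_cases h : w j = 1
    · simp [h]
    · rw [if_neg h, if_neg (by omega)]
  have hA : ((coeffLayer d).toLayer.attn fun k => slots ![x k, 0, y k, p k]
          ![S * N, t k, S * q k, if 1 ≤ w k then 1 else 0, 1, S, S * w k, S * (k + 1)]) =
      fun k => slots ![x k, 0, y k, p k]
          ![S * N, t k, S * q k, (if 1 ≤ w k then 1 else 0) + ∑ j, gate (∑ i, y k i * x j i) S
    (-S + S * w j) * if 1 ≤ w j then 1 else 0, 1, S, S * w k, S * (k + 1)] := by
    funext j
    apply coord_ext
    · intro a i
      rw [attn_apply _ _ coeffLayer_small (by simp)]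
      fin_cases a <;> simp [coeffLayer]
    · intro a
      rw [attn_apply _ _ coeffLayer_small (by simp)]
      fin_cases a <;> simp [coeffLayer, contentVal]
  rw [hA]
  funext j
  have h0 : 0 ≤ S := by linarith
  apply coord_ext
  · intro a i
    rw [ffn_apply _ _ _ coeffLayer_small]
    fin_cases a <;> simp [coeffLayer]
  · intro a
    rw [ffn_apply _ _ _ coeffLayer_small]
    -- `e1` yields the label added to the layer index, `e2` the one replacing the predecessor index.
    have e1 := relu_detect h0 (w j - q j - 1)
    have e2 := relu_detect h0 (q j - w j - 1)
    simp only [sub_sub, sub_eq_zero] at e1 e2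
    push_cast at e1 e2
    -- Nonnegativity lets one unit erase the old value; with the four detecting units this exhausts
    -- the budget of five.
    have e3 : relu (S * q j) = S * q j := max_eq_right (mul_nonneg h0 (by exact_mod_cast hq j))
    fin_cases a <;> simp [coeffLayer, -mul_ite]
    · rw [e3, ← e2]
      ring_nf
    · have e4 : S / 2 * (if w j = q j + 1 then 0 else 1) =
          1 / 2 * (S * if w j = q j + 1 then 0 else 1) := by ring
      rw [e4, ← e1]
      ring_nf

/-- The gate attends to the same position as `targetLayer`, doubled so that the label of `P` can be
added. As before, the result is identified only at queries whose content is bounded. -/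
theorem tail_step (y p : Fin n → Fin d → ℝ) (t c r : Fin n → ℝ)
    (P : Fin n → Prop) [DecidablePred P] :
    ∃ z : Fin n → Fin d → ℝ,
      (∀ k, (∀ j i, p j i ≠ 0 → |c k| ≤ S) →
        ∀ i, z k i = ∑ j : Fin n, if (j : ℕ) + N = k + 1 ∧ P j then c k * p j i else 0) ∧
      (tailLayer d).toLayer.ffn relu ((tailLayer d).toLayer.attn
        fun k => slots ![x k, 0, y k, p k]
          ![S * N, t k, S * if P k then 0 else 1, c k, 1, S, r k, S * (k + 1)]) =
      fun k => slots ![x k, z k, y k, p k]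
        ![S * N, t k, S * if P k then 0 else 1, c k, 1, S, r k, S * (k + 1)] := by
  refine ⟨fun k i => ∑ j : Fin n, gate (c k) S (-(2 * (S * (k + 1))) + (-(2 * S) + 2 * (S * N)) +
      (2 * (S * (j + 1)) + S * if P j then 0 else 1)) * p j i, fun k hb i => ?_, ?_⟩
  · beta_reduce
    rw [sum_gate _ _ _ (fun j => (2 * j - 2 * k - 2 + 2 * N + if P j then 0 else 1 : ℤ))
      (fun j => by push_cast; ring) (fun j => hb j i)]
    refine Finset.sum_congr rfl fun j _ => if_congr ?_ rfl rfl
    split_ifs with h <;> simp only [h, and_true, and_false, iff_false] <;> omega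
  have hA : ∀ H : Fin n → Fin (4 * d + 8) → ℝ, (tailLayer d).toLayer.ffn relu H = H := by
    intro H
    funext j
    apply coord_ext
    · intro a i
      rw [ffn_apply _ _ _ tailLayer_small]
      fin_cases a <;> simp [tailLayer]
    · intro a
      rw [ffn_apply _ _ _ tailLayer_small]
      fin_cases a <;> simp [tailLayer]
  rw [hA]
  funext j
  apply coord_ext
  · intro a i
    rw [attn_apply _ _ tailLayer_small (by simp)]
    fin_cases a <;> simp [tailLayer, contentVal, -mul_ite]
  · intro a
    rw [attn_apply _ _ tailLayer_small (by simp)]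
    fin_cases a <;> simp [tailLayer, -mul_ite]

/-- Score times value is the action of a rank-one matrix on `y j`. Only the column `j` is described,
since generation reads only the last one and the bound is available only there. -/
theorem pair_step (hS : 1 ≤ S) (z y p : Fin n → Fin d → ℝ) (t : Fin n → ℤ) (r₀ r₂ r₃ : Fin n → ℝ)
    (P : Fin n → Prop) [DecidablePred P] (j : Fin n)
    (hb : ∀ k i, p k i ≠ 0 → |∑ i, y j i * x k i| ≤ S) :
    (pairLayer d).toLayer.ffn relu ((pairLayer d).toLayer.attn
        fun k => slots ![x k, z k, y k, p k]
          ![r₀ k, S * t k, r₂ k, r₃ k, 1, S, S * w k + S / 2 * if P k then 0 else 1,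
            S * (k + 1)]) j =
      token (fun i => z j i + ∑ k, if w k = 2 - 2 * t j ∧ P k then
        (∑ i, y j i * x k i) * p k i else 0) (t j - 1) (j + 2) S := by
  have h0 : 0 ≤ S := by linarith
  have hg : ∀ i, ∑ k, gate (∑ i, y j i * x k i) S (-(4 * S) + 4 * (S * t j) +
      2 * (S * w k + S / 2 * if P k then 0 else 1)) * p k i =
      ∑ k, if w k = 2 - 2 * t j ∧ P k then (∑ i, y j i * x k i) * p k i else 0 := by
    intro i
    -- Doubling the index slot turns its half-integral label into a 0/1 term beside an even number,
    -- so both conditions are tested together.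
    rw [sum_gate _ _ _ (fun k => (-4 + 4 * t j + 2 * w k + if P k then 0 else 1 : ℤ))
      (fun k => by push_cast; ring) (fun k => hb k i)]
    refine Finset.sum_congr rfl fun j _ => if_congr ?_ rfl rfl
    split_ifs with h <;> simp only [h, and_true, and_false, iff_false] <;> omega
  set H : Fin n → Fin (4 * d + 8) → ℝ := fun k => slots ![x k, z k, y k, p k]
          ![r₀ k, S * t k, r₂ k, r₃ k, 1, S, S * w k + S / 2 * if P k then 0 else 1,
            S * (k + 1)] with hH
  set u : Fin d → ℝ := fun i => z j i + ∑ k, if w k = 2 - 2 * t j ∧ P k then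
    (∑ i, y j i * x k i) * p k i else 0 with hu
  have hA : (pairLayer d).toLayer.attn H j = slots ![x j, u, y j, p j]
          ![r₀ j, S * t j, r₂ j, r₃ j, 1, S, S * w j + S / 2 * if P j then 0 else 1,
            S * (j + 1)] := by
    apply coord_ext
    · intro a i
      rw [attn_apply _ _ pairLayer_small (by simp [hH])]
      fin_cases a <;> simp [pairLayer, contentVal, hH, hu, hg, -mul_ite]
    · intro a
      rw [attn_apply _ _ pairLayer_small (by simp [hH])]
      fin_cases a <;> simp [pairLayer, hH, -mul_ite]
  -- Two units fed with ±(b - a) overwrite a coordinate a by b through the residual connection.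
  have hneg : ∀ a b : ℝ, a + (relu (-a + b) + -relu (-b + a)) = b := by
    intro a b
    have := relu_add_neg_relu_neg (-a + b)
    rw [show -(-a + b) = -b + a by ring] at this
    linarith
  rw [token_eq_slots]
  apply coord_ext
  · intro a i
    rw [ffn_apply _ _ _ pairLayer_small, hA]
    fin_cases a <;> simp [pairLayer, add_neg_relu_add_relu_neg]
    rw [add_comm (u i)]
    exact hneg _ _
  · intro a
    rw [ffn_apply _ _ _ pairLayer_small, hA]
    have := hneg (S * w j + S / 2 * if P j then 0 else 1) (S * t j - S)
    have h7 : relu S = S := max_eq_right h0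
    fin_cases a <;> simp [pairLayer, add_neg_relu_add_relu_neg, -mul_ite]
    · rw [mul_sub, mul_one, ← this]
      ring_nf
    · rw [h7]
      ring

end LayerSpec

/-! ### One generation step of the emulator -/

namespace LayerSpec

variable {d : ℕ}

/-- The token generated by the emulator after a sequence of tokens whose last one does not belong
to the prompt. -/
theorem emulator_last {m N : ℕ} {S : ℝ} (x : Fin (m + 1) → Fin d → ℝ) (w : Fin (m + 1) → ℤ)
    (hS : 1 ≤ S) (hN : (∑ k, if w k = 0 then 1 else 0) = N) (p : Fin (m + 1))
    (hp : (p : ℕ) + N = m + 1) (hlast : w (Fin.last m) ≤ 0)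
    (hb : ∀ k, 1 ≤ w k → |∑ i, euaf (x p i) * x k i| ≤ S)
    (hb' : ∀ k i, predVec x w k i ≠ 0 → |∑ i, euaf (x p i) * x k i| ≤ S)
    (hc : |tailCoeff x w fun i => euaf (x p i)| ≤ S) :
    euafTransformer ((emulator d).map toLayer) (fun k => token (x k) (w k) (k + 1) S)
        (Fin.last m) =
      token (fun i => (if predIdx w p = w p + 1 then
          tailCoeff x w (fun i => euaf (x p i)) * predVec x w p i else 0) +
        ∑ k, if w k = 2 - 2 * w p ∧ w k = predIdx w k + 1 then
          (∑ i, euaf (x p i) * x k i) * predVec x w k i else 0) (w p - 1) (m + 2) S := by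
  -- For the last token the position equation has the single solution `p`, so the sums defining the
  -- target collapse.
  have hj : ∀ j : Fin (m + 1), (j : ℕ) + N = (Fin.last m : ℕ) + 1 ↔ j = p := by
    intro j
    rw [Fin.val_last, Fin.ext_iff]
    omega
  have hy : targetVec x N (Fin.last m) = fun i => euaf (x p i) := by
    funext i
    simp [targetVec, hj, -Fin.val_last]
  have hw : targetIdx w N (Fin.last m) = w p := by
    simp [targetIdx, hj, -Fin.val_last]
  obtain ⟨c, hc', h4⟩ := coeff_step (w := w) (N := N) x hS (targetVec x N) (predVec x w)
    (fun k => S * targetIdx w N k) (predIdx w) predIdx_nonneg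
  have hcl : c (Fin.last m) = tailCoeff x w fun i => euaf (x p i) := by
    rw [hc' _ hlast (by rw [hy]; exact hb), hy]
  obtain ⟨z, hz, h5⟩ := tail_step (N := N) (S := S) x (targetVec x N) (predVec x w)
    (fun k => S * targetIdx w N k) c (fun k => S * w k + S / 2 * if w k = predIdx w k + 1 then 0
      else 1) (fun k => predIdx w k = w k + 1)
  simp only [emulator, List.map_cons, List.map_nil, euafTransformer, List.foldl_cons,
    List.foldl_nil, idLayer_attn, idLayer_ffn]
  rw [count_step x w N hS hN, target_step x hS, pred_step x hS, h4, h5,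
    pair_step x hS _ _ _ _ _ _ _ _ _ (by rw [hy]; exact hb'), hw, hy]
  congr 1
  funext i
  rw [hz _ (fun j i _ => by rw [hcl]; exact hc), hcl]
  congr 1
  simp only [hj]
  rw [Finset.sum_eq_single p]
  · simp
  · intro j _ hjp
    simp [hjp]
  · simp

end LayerSpec

/-! ### The activation and the generation recursion -/

theorem euaf_of_mem_Icc {r : ℝ} (h : r ∈ Set.Icc (0 : ℝ) 1) : euaf r = r := by
  rw [euaf, if_pos h.1]
  rcases h.2.lt_or_eq with h1 | h1
  · have : ⌊(r + 1) / 2⌋ = 0 := by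
      rw [Int.floor_eq_zero_iff]
      constructor <;> linarith [h.1]
    rw [this]
    simp [abs_of_nonneg h.1]
  · subst h1
    norm_num

/-- This keeps attention scores bounded independently of depth, so bounds on the virtual layers
themselves are not needed. -/
theorem abs_euaf_le (r : ℝ) : |euaf r| ≤ 1 := by
  rw [euaf]
  split_ifs with h
  · rw [abs_abs]
    have h1 := Int.floor_le ((r + 1) / 2)
    have h2 := Int.lt_floor_add_one ((r + 1) / 2)
    rw [abs_le]
    constructor <;> linarith
  · rw [abs_div, abs_of_pos (by positivity : 0 < 1 + |r|), div_le_one (by positivity)]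
    linarith

theorem sum_eq_sum_castLE {M : Type*} [AddCommMonoid M] {T n : ℕ} (h : T ≤ n) (F : Fin n → M)
    (h0 : ∀ k : Fin n, T ≤ k → F k = 0) : ∑ k, F k = ∑ k : Fin T, F (Fin.castLE h k) := by
  symm
  refine Fintype.sum_of_injective _ (Fin.castLE_injective h) _ _ (fun k hk => h0 k ?_) fun _ => rfl
  by_contra hkT
  exact hk ⟨⟨k, not_le.1 hkT⟩, rfl⟩

theorem generatedToken_of_lt {D n : ℕ} (Θ : List (TFLayer D)) (H : Fin n → Fin D → ℝ) {q : ℕ}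
    (h : q < n) : generatedToken Θ H q = H ⟨q, h⟩ := by
  cases q with
  | zero => rw [generatedToken, dif_pos h]
  | succ q => rw [generatedToken, dif_pos h]

theorem generatedToken_succ {D n : ℕ} (Θ : List (TFLayer D)) (H : Fin n → Fin D → ℝ) {q : ℕ}
    (h : n ≤ q + 1) : generatedToken Θ H (q + 1) =
      euafTransformer Θ (fun i : Fin (q + 1) => generatedToken Θ H i) (Fin.last q) := by
  rw [generatedToken, dif_neg (not_lt.2 h)]

/-- The activation fixes inputs in [0,1], which makes the recursion uniform in ℓ including the first
layer. -/
theorem networkLayer_succ {d : ℕ} (W : ℕ → Matrix (Fin d) (Fin d) ℝ) (z : Fin d → ℝ)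
    (hz : ∀ k, z k ∈ Set.Icc (0 : ℝ) 1) (ℓ : ℕ) :
    networkLayer euaf W z (ℓ + 1) =
      W (ℓ + 1) *ᵥ fun k => euaf (networkLayer euaf W z ℓ k) := by
  cases ℓ with
  | zero =>
    simp only [networkLayer, zero_add]
    congr 1
    exact funext fun k => (euaf_of_mem_Icc (hz k)).symm
  | succ ℓ => rw [networkLayer]

/-! ### The virtual sequence and its weight matrices -/

variable {d T N : ℕ}

/-- The embedding of the token number `q` (counted from `0`) of the generated sequence. -/
def virtualVec (u : Fin T → EuclideanSpace ℝ (Fin d)) (w : Fin T → ℤ) (z : Fin N → Fin d → ℝ)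
    (hN : 0 < N) (q : ℕ) : Fin d → ℝ :=
  if h : q < T then (u ⟨q, h⟩).ofLp
  else networkLayer euaf (promptWeight u w ((q - T) % N)) (z ⟨(q - T) % N, Nat.mod_lt _ hN⟩)
    ((q - T) / N)

/-- The layer index of the token number `q` (counted from `0`) of the generated sequence. -/
def virtualIdx (w : Fin T → ℤ) (N q : ℕ) : ℤ :=
  if h : q < T then w ⟨q, h⟩ else -(((q - T) / N : ℕ) : ℤ)

section

variable (u : Fin T → EuclideanSpace ℝ (Fin d)) (w : Fin T → ℤ) (z : Fin N → Fin d → ℝ)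
  (hN : 0 < N)

theorem virtualVec_of_lt (k : Fin T) : virtualVec u w z hN k = (u k).ofLp := by
  simp [virtualVec]

theorem virtualIdx_of_lt (k : Fin T) : virtualIdx w N k = w k := by
  simp [virtualIdx]

variable {w}

theorem virtualIdx_nonpos {q : ℕ} (h : T ≤ q) : virtualIdx w N q ≤ 0 := by
  rw [virtualIdx, dif_neg (not_lt.2 h)]
  exact neg_nonpos.2 (Int.natCast_nonneg _)

theorem lt_of_one_le_virtualIdx {q : ℕ} (h : 1 ≤ virtualIdx w N q) : q < T := by
  by_contra hq
  have := virtualIdx_nonpos (w := w) (N := N) (not_lt.1 hq)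
  omega

include hN in
theorem virtualIdx_eq_zero (hw : ∀ j, 1 ≤ w j) (q : ℕ) :
    virtualIdx w N q = 0 ↔ q ∈ Finset.Ico T (T + N) := by
  rw [virtualIdx, Finset.mem_Ico]
  split_ifs with h
  · have := hw ⟨q, h⟩
    omega
  · rw [neg_eq_zero, Int.natCast_eq_zero, Nat.div_eq_zero_iff]
    omega

include hN in
theorem count_virtualIdx (hw : ∀ j, 1 ≤ w j) {n : ℕ} (hn : T + N ≤ n) :
    (∑ k : Fin n, if virtualIdx w N k = 0 then 1 else 0) = N := by
  rw [Fin.sum_univ_eq_sum_range (fun k => if virtualIdx w N k = 0 then 1 else 0) n,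
    ← Finset.sum_filter, Finset.sum_const, smul_eq_mul, mul_one]
  have : (Finset.range n).filter (fun k => virtualIdx w N k = 0) = Finset.Ico T (T + N) := by
    ext k
    rw [Finset.mem_filter, virtualIdx_eq_zero hN hw, Finset.mem_range, Finset.mem_Ico]
    omega
  rw [this, Nat.card_Ico]
  omega

theorem predVec_virtual (hw : ∀ j, 1 ≤ w j) {n : ℕ} (hn : T ≤ n) (k : Fin n) (r : Fin d) :
    LayerSpec.predVec (fun k : Fin n => virtualVec u w z hN k) (fun k => virtualIdx w N k) k r =
      ∑ j : Fin T, if (j : ℕ) + 1 = k then (u j).ofLp r else 0 := by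
  rw [LayerSpec.predVec, sum_eq_sum_castLE hn]
  · refine Finset.sum_congr rfl fun j _ => ?_
    simp [virtualVec_of_lt, virtualIdx_of_lt, hw]
  · intro j hj
    have := virtualIdx_nonpos (w := w) (N := N) hj
    rw [if_neg (by omega)]

theorem predIdx_virtual (hw : ∀ j, 1 ≤ w j) {n : ℕ} (hn : T ≤ n) (k : Fin n) :
    LayerSpec.predIdx (fun k : Fin n => virtualIdx w N k) k =
      ∑ j : Fin T, if (j : ℕ) + 1 = k then w j else 0 := by
  rw [LayerSpec.predIdx, sum_eq_sum_castLE hn]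
  · refine Finset.sum_congr rfl fun j _ => ?_
    simp [virtualIdx_of_lt, hw]
  · intro j hj
    have := virtualIdx_nonpos (w := w) (N := N) hj
    rw [if_neg (by omega)]

theorem tailCoeff_virtual {n : ℕ} (hn : T ≤ n) (y : Fin d → ℝ) :
    LayerSpec.tailCoeff (fun k : Fin n => virtualVec u w z hN k) (fun k => virtualIdx w N k) y =
      ∑ j : Fin T, if w j = 1 then ∑ i, y i * (u j).ofLp i else 0 := by
  rw [LayerSpec.tailCoeff, sum_eq_sum_castLE hn]
  · refine Finset.sum_congr rfl fun j _ => ?_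
    simp [virtualVec_of_lt, virtualIdx_of_lt]
  · intro j hj
    have := virtualIdx_nonpos (w := w) (N := N) hj
    rw [if_neg (by omega)]

theorem sum_succ_eq {M : Type*} [AddCommMonoid M] {k : ℕ} (F : Fin T → M) (j : Fin T)
    (h : (j : ℕ) + 1 = k) : (∑ j : Fin T, if (j : ℕ) + 1 = k then F j else 0) = F j := by
  rw [Finset.sum_eq_single j]
  · rw [if_pos h]
  · intro i _ hi
    rw [if_neg fun h' => hi (Fin.ext (by omega))]
  · simp

theorem sum_succ_eq_zero {M : Type*} [AddCommMonoid M] {k : ℕ} (F : Fin T → M)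
    (h : k = 0 ∨ T < k) : (∑ j : Fin T, if (j : ℕ) + 1 = k then F j else 0) = 0 :=
  Finset.sum_eq_zero fun j _ => if_neg (by omega)

theorem ite_vecMulVec_mulVec {P : Prop} [Decidable P] (a b y : Fin d → ℝ) (r : Fin d) :
    ((if P then Matrix.vecMulVec a b else 0) *ᵥ y) r =
      if P then (∑ i, y i * b i) * a r else 0 := by
  split_ifs
  · rw [Matrix.vecMulVec_mulVec]
    simp [dotProduct, mul_comm]
  · simp

variable (w)

theorem pairWeight_mulVec (ℓ : ℕ) (y : Fin d → ℝ) (r : Fin d) :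
    (pairWeight u w ℓ *ᵥ y) r = ∑ k : Fin T, ∑ j : Fin T,
      if (k : ℕ) = j + 1 ∧ w j = 2 * (ℓ : ℤ) - 1 ∧ w k = 2 * (ℓ : ℤ) then
        (∑ i, y i * (u k).ofLp i) * (u j).ofLp r else 0 := by
  rw [pairWeight, Finset.sum_comm]
  simp only [Matrix.sum_mulVec, Finset.sum_apply, ite_vecMulVec_mulVec]

theorem tailWeight_mulVec (y : Fin d → ℝ) (r : Fin d) :
    (tailWeight u w *ᵥ y) r = ∑ j : Fin T, if (j : ℕ) + 1 = T then
      (if w j = 1 then (∑ k : Fin T, if w k = 1 then ∑ i, y i * (u k).ofLp i else 0) *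
        (u j).ofLp r else 0) else 0 := by
  rw [tailWeight]
  simp only [Matrix.sum_mulVec, Finset.sum_apply, ite_vecMulVec_mulVec]
  refine Finset.sum_congr rfl fun j _ => ?_
  by_cases h : (j : ℕ) + 1 = T
  · by_cases h' : w j = 1
    · simp [h, h', Finset.sum_mul]
    · simp [h']
  · simp [h]

variable {w}

/-- The pair layer of the emulator multiplies by `pairWeight`. -/
theorem sum_pair_virtual (hw : ∀ j, 1 ≤ w j) {n : ℕ} (hn : T ≤ n) (ℓ : ℕ) (y : Fin d → ℝ)
    (r : Fin d) :
    (∑ k : Fin n, if virtualIdx w N k = 2 * ((ℓ + 1 : ℕ) : ℤ) ∧ virtualIdx w N k =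
        LayerSpec.predIdx (fun k : Fin n => virtualIdx w N k) k + 1 then
      (∑ i, y i * virtualVec u w z hN k i) *
        LayerSpec.predVec (fun k : Fin n => virtualVec u w z hN k) (fun k => virtualIdx w N k) k r
      else 0) = (pairWeight u w (ℓ + 1) *ᵥ y) r := by
  rw [pairWeight_mulVec, sum_eq_sum_castLE hn]
  · refine Finset.sum_congr rfl fun k _ => ?_
    rw [predVec_virtual u z hN hw hn, predIdx_virtual hw hn]
    simp only [Fin.val_castLE, virtualVec_of_lt, virtualIdx_of_lt]
    rcases Nat.eq_zero_or_pos (k : ℕ) with h | h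
    · rw [sum_succ_eq_zero _ (.inl h), sum_succ_eq_zero _ (.inl h), mul_zero, ite_self]
      exact (Finset.sum_eq_zero fun j _ => if_neg (by omega)).symm
    · have hk := k.isLt
      let j : Fin T := ⟨k - 1, by omega⟩
      have hj : (j : ℕ) + 1 = k := by simp only [j]; omega
      rw [sum_succ_eq _ j hj, sum_succ_eq _ j hj, Finset.sum_eq_single j]
      · exact if_congr (by omega) rfl rfl
      · intro i _ hi
        rw [if_neg fun h' => hi (Fin.ext (by omega))]
      · simp
  · intro k hk
    have := virtualIdx_nonpos (w := w) (N := N) hk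
    rw [if_neg (by omega)]

/-- The tail layer of the emulator multiplies by `tailWeight` for the first data token, and by
zero otherwise. -/
theorem tail_virtual (hw : ∀ j, 1 ≤ w j) {n : ℕ} (p : Fin n) (hp : T ≤ p) (y : Fin d → ℝ)
    (r : Fin d) :
    (if LayerSpec.predIdx (fun k : Fin n => virtualIdx w N k) p = virtualIdx w N p + 1 then
      LayerSpec.tailCoeff (fun k : Fin n => virtualVec u w z hN k) (fun k => virtualIdx w N k) y *
        LayerSpec.predVec (fun k : Fin n => virtualVec u w z hN k) (fun k => virtualIdx w N k) p r
      else 0) = if (p : ℕ) = T then (tailWeight u w *ᵥ y) r else 0 := by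
  have hn : T ≤ n := hp.trans p.isLt.le
  rw [predVec_virtual u z hN hw hn, predIdx_virtual hw hn, tailCoeff_virtual u z hN hn,
    tailWeight_mulVec]
  rcases hp.eq_or_lt with h | h
  · rw [if_pos h.symm, ← h]
    have h0 : virtualIdx w N T = 0 := (virtualIdx_eq_zero hN hw T).2 (by simp [hN])
    rw [h0]
    rcases Nat.eq_zero_or_pos T with hT | hT
    · rw [sum_succ_eq_zero _ (.inl hT), sum_succ_eq_zero _ (.inl hT), sum_succ_eq_zero _ (.inl hT)]
      simp
    · let j : Fin T := ⟨T - 1, by omega⟩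
      have hj : (j : ℕ) + 1 = T := by simp only [j]; omega
      rw [sum_succ_eq _ j hj, sum_succ_eq _ j hj, sum_succ_eq _ j hj]
      simp
  -- Behind the first data token the predecessor lies outside the prompt. The index test can still
  -- succeed (index -1 against 0), but the predecessor vector is zero.
  · rw [if_neg h.ne', sum_succ_eq_zero _ (.inr h), sum_succ_eq_zero _ (.inr h), mul_zero, ite_self]

end

/-! ### Induction over the generated tokens -/

theorem abs_sum_euaf_mul_le {B S : ℝ} (hdB : d * B ≤ S) (y v : Fin d → ℝ)
    (hv : ∀ i, |v i| ≤ B) : |∑ i, euaf (y i) * v i| ≤ S := by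
  refine (Finset.abs_sum_le_sum_abs _ _).trans (le_trans ?_ hdB)
  calc ∑ i, |euaf (y i) * v i| ≤ ∑ _i : Fin d, B := Finset.sum_le_sum fun i _ => by
        rw [abs_mul]
        nlinarith [abs_euaf_le (y i), hv i, abs_nonneg (v i), abs_nonneg (euaf (y i))]
    _ = d * B := by simp

/-- All generated tokens. -/
theorem generatedToken_emulator {B S : ℝ} (u : Fin T → EuclideanSpace ℝ (Fin d)) (w : Fin T → ℤ)
    (z : Fin N → Fin d → ℝ) (hN : 0 < N) (hS : 1 ≤ S) (hB : 1 ≤ B)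
    (hu : ∀ j i, |(u j).ofLp i| ≤ B) (hw : ∀ j, 1 ≤ w j)
    (hz : ∀ i k, z i k ∈ Set.Icc (0 : ℝ) 1) (hdB : 0 < T → d * B ≤ S)
    (hcard : (Finset.univ.filter fun j => w j = 1).card * (d * B) ≤ S) (q : ℕ) :
    generatedToken ((LayerSpec.emulator d).map LayerSpec.toLayer) (inputSequence u w z S) q =
      token (virtualVec u w z hN q) (virtualIdx w N q) (q + 1) S := by
  induction q using Nat.strong_induction_on with
  | _ q ih =>
  rcases lt_or_ge q (T + N) with hq | hq
  · rw [generatedToken_of_lt _ _ hq]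
    rcases lt_or_ge q T with h | h
    · have : (⟨q, hq⟩ : Fin (T + N)) = Fin.castAdd N ⟨q, h⟩ := rfl
      rw [this, inputSequence, Fin.append_left]
      simp [virtualVec, virtualIdx, h]
    · have : (⟨q, hq⟩ : Fin (T + N)) = Fin.natAdd T ⟨q - T, by omega⟩ :=
        Fin.ext (by simp; omega)
      have h1 : (q - T) % N = q - T := Nat.mod_eq_of_lt (by omega)
      have h2 : (q - T) / N = 0 := Nat.div_eq_of_lt (by omega)
      rw [this, inputSequence, Fin.append_right, virtualIdx, virtualVec, dif_neg (not_lt.2 h),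
        dif_neg (not_lt.2 h)]
      simp only [h1, h2, networkLayer, Nat.cast_zero, neg_zero]
      congr 1
      omega
  obtain ⟨m, rfl⟩ : ∃ m, q = m + 1 := ⟨q - 1, by omega⟩
  rw [generatedToken_succ _ _ hq]
  have hseq : (fun k : Fin (m + 1) => generatedToken
      ((LayerSpec.emulator d).map LayerSpec.toLayer) (inputSequence u w z S) k) =
      fun k : Fin (m + 1) => token (virtualVec u w z hN k) (virtualIdx w N k) (k + 1) S :=
    funext fun k => ih k k.isLt
  rw [hseq]
  -- The token N places before the new one: same data token, one virtual layer lower.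
  let p : Fin (m + 1) := ⟨m + 1 - N, by omega⟩
  have hpv : (p : ℕ) = m + 1 - N := rfl
  have hTp : T ≤ p := by omega
  obtain ⟨ℓ, i, hi, hpe⟩ : ∃ ℓ i, i < N ∧ (p : ℕ) - T = N * ℓ + i :=
    ⟨_, _, Nat.mod_lt _ hN, (Nat.div_add_mod ((p : ℕ) - T) N).symm⟩
  have hp1 : ((p : ℕ) - T) % N = i := by rw [hpe, Nat.mul_add_mod, Nat.mod_eq_of_lt hi]
  have hp2 : ((p : ℕ) - T) / N = ℓ := by
    rw [hpe, Nat.mul_add_div hN, Nat.div_eq_of_lt hi, add_zero]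
  have hqe : m + 1 - T = N * (ℓ + 1) + i := by rw [mul_add, mul_one]; omega
  have hq1 : (m + 1 - T) % N = i := by rw [hqe, Nat.mul_add_mod, Nat.mod_eq_of_lt hi]
  have hq2 : (m + 1 - T) / N = ℓ + 1 := by
    rw [hqe, Nat.mul_add_div hN, Nat.div_eq_of_lt hi, add_zero]
  have hidx : virtualIdx w N p = -(ℓ : ℤ) := by
    rw [virtualIdx, dif_neg (not_lt.2 hTp), hp2]
  have hvec : virtualVec u w z hN p =
      networkLayer euaf (promptWeight u w i) (z ⟨i, hi⟩) ℓ := by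
    rw [virtualVec, dif_neg (not_lt.2 hTp)]
    simp only [hp1, hp2]
  have hidx' : virtualIdx w N (m + 1) = -((ℓ + 1 : ℕ) : ℤ) := by
    rw [virtualIdx, dif_neg (by omega), hq2]
  have hvec' : virtualVec u w z hN (m + 1) =
      networkLayer euaf (promptWeight u w i) (z ⟨i, hi⟩) (ℓ + 1) := by
    rw [virtualVec, dif_neg (by omega)]
    simp only [hq1, hq2]
  have hpT : (p : ℕ) = T ↔ ℓ + 1 = 1 ∧ i = 0 := by
    constructor
    · intro h
      have h0 : N * ℓ + i = 0 := by omega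
      have h1 : N * ℓ = 0 := by omega
      rcases Nat.mul_eq_zero.1 h1 with h2 | h2 <;> omega
    · rintro ⟨h1, h2⟩
      have h3 : ℓ = 0 := by omega
      rw [h3, h2] at hpe
      omega
  have hTn : T ≤ m + 1 := by omega
  rw [LayerSpec.emulator_last (N := N) _ _ hS (count_virtualIdx hN hw hq) p (by omega)
    (virtualIdx_nonpos (by simp; omega))]
  · rw [hidx', hvec', networkLayer_succ _ _ (hz _)]
    congr 1
    · funext r
      -- The index -ℓ of the processed token selects the even label 2(ℓ + 1) of the next layer.
      have h2 : 2 - 2 * virtualIdx w N p = 2 * ((ℓ + 1 : ℕ) : ℤ) := by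
        rw [hidx]
        push_cast
        ring
      rw [h2, sum_pair_virtual u z hN hw hTn, tail_virtual u z hN hw p hTp, hvec, promptWeight,
        Matrix.add_mulVec, Pi.add_apply, add_comm]
      congr 1
      by_cases h : (p : ℕ) = T
      · rw [if_pos h, if_pos (hpT.1 h)]
      · rw [if_neg h, if_neg fun h' => h (hpT.2 h'), Matrix.zero_mulVec, Pi.zero_apply]
    · rw [hidx]
      push_cast
      ring
  · intro k hk
    have hkT := lt_of_one_le_virtualIdx hk
    refine abs_sum_euaf_mul_le (hdB (by omega)) _ _ fun i => ?_
    rw [virtualVec, dif_pos hkT]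
    exact hu _ _
  · intro k r hk
    rw [predVec_virtual u z hN hw hTn] at hk
    have hkT : ¬ ((k : ℕ) = 0 ∨ T < k) := fun h => hk (sum_succ_eq_zero _ h)
    refine abs_sum_euaf_mul_le (hdB (by omega)) _ _ fun i => ?_
    rw [virtualVec]
    split_ifs with h
    · exact hu _ _
    -- Besides prompt tokens, the first data token also has a prompt predecessor; its own entries
    -- lie in [0,1] and B ≥ 1.
    · have h1 : (k : ℕ) - T = 0 := by omega
      simp only [h1, Nat.zero_mod, Nat.zero_div, networkLayer]
      have := hz ⟨0, hN⟩ i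
      rw [abs_of_nonneg this.1]
      exact this.2.trans hB
  · rw [tailCoeff_virtual u z hN hTn, ← Finset.sum_filter]
    refine (Finset.abs_sum_le_sum_abs _ _).trans (le_trans ?_ hcard)
    rw [← nsmul_eq_mul]
    exact Finset.sum_le_card_nsmul _ _ _ fun j _ => abs_sum_euaf_mul_le le_rfl _ _ (hu j)

/-- The generated token number `T + N ℓ + i`. -/
theorem generatedToken_emulator_layer {B S : ℝ} (u : Fin T → EuclideanSpace ℝ (Fin d))
    (w : Fin T → ℤ) (z : Fin N → Fin d → ℝ) (hN : 0 < N) (hS : 1 ≤ S) (hB : 1 ≤ B)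
    (hu : ∀ j i, |(u j).ofLp i| ≤ B) (hw : ∀ j, 1 ≤ w j)
    (hz : ∀ i k, z i k ∈ Set.Icc (0 : ℝ) 1) (hdB : 0 < T → d * B ≤ S)
    (hcard : (Finset.univ.filter fun j => w j = 1).card * (d * B) ≤ S) (i : Fin N) (ℓ : ℕ) :
    generatedToken ((LayerSpec.emulator d).map LayerSpec.toLayer) (inputSequence u w z S)
        (T + N * ℓ + i) =
      token (networkLayer euaf (promptWeight u w i) (z i) ℓ) (-(ℓ : ℤ)) (T + N * ℓ + (i + 1)) S := by
  rw [generatedToken_emulator u w z hN hS hB hu hw hz hdB hcard]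
  have h0 : T + N * ℓ + i - T = N * ℓ + i := by omega
  have h1 : (T + N * ℓ + i - T) % N = i := by
    rw [h0, Nat.mul_add_mod, Nat.mod_eq_of_lt i.isLt]
  have h2 : (T + N * ℓ + i - T) / N = ℓ := by
    rw [h0, Nat.mul_add_div hN, Nat.div_eq_of_lt i.isLt, add_zero]
  rw [virtualIdx, virtualVec, dif_neg (by omega), dif_neg (by omega)]
  simp only [h1, h2, Fin.eta]
  rfl

/-! ### Prompts for prescribed coarse networks -/

theorem networkLayer_congr {d : ℕ} (σ : ℝ → ℝ) {W W' : ℕ → Matrix (Fin d) (Fin d) ℝ}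
    (z : Fin d → ℝ) (ℓ : ℕ) (h : ∀ m ∈ Finset.Icc 1 ℓ, W m = W' m) :
    networkLayer σ W z ℓ = networkLayer σ W' z ℓ := by
  induction ℓ with
  | zero => rfl
  | succ ℓ ih =>
    have ih' := ih fun m hm => h m (by rw [Finset.mem_Icc] at hm ⊢; omega)
    have hℓ := h (ℓ + 1) (by rw [Finset.mem_Icc]; omega)
    cases ℓ with
    | zero => rw [networkLayer, networkLayer, hℓ]
    | succ ℓ => rw [networkLayer, networkLayer, hℓ, ih']

theorem abs_coord_le {d : ℕ} {U : Set (EuclideanSpace ℝ (Fin d))} {B : ℝ}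
    (hU : U ⊆ Metric.closedBall 0 B) {v : EuclideanSpace ℝ (Fin d)} (hv : v ∈ U) (i : Fin d) :
    |v.ofLp i| ≤ B := by
  have h : ‖v‖ ≤ B := mem_closedBall_zero_iff.1 (hU hv)
  exact (PiLp.norm_apply_le v i).trans h

/-- Labelling the elements of `Fin (∑ r ℓ)` by pairs `(ℓ, k)` with `k < r ℓ`. -/
theorem exists_labelling (L : ℕ) (r : ℕ → ℕ) :
    ∃ e : Fin (∑ ℓ ∈ Finset.Icc 1 L, r ℓ) → Σ ℓ, Fin (r ℓ), (∀ q, (e q).1 ∈ Finset.Icc 1 L) ∧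
      ∀ {M : Type} [AddCommMonoid M] (G : (Σ ℓ, Fin (r ℓ)) → M), ∀ ℓ ∈ Finset.Icc 1 L,
        (∑ q, if (e q).1 = ℓ then G (e q) else 0) = ∑ k, G ⟨ℓ, k⟩ := by
  let s : Finset (Σ ℓ, Fin (r ℓ)) := (Finset.Icc 1 L).sigma fun ℓ => Finset.univ
  have hs : s.card = ∑ ℓ ∈ Finset.Icc 1 L, r ℓ := by simp [s]
  let e := s.equivFinOfCardEq hs
  refine ⟨fun q => (e.symm q).1, fun q => (Finset.mem_sigma.1 (e.symm q).2).1, ?_⟩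
  intro M _ G ℓ hℓ
  rw [e.symm.sum_comp (fun σ : s => if σ.1.1 = ℓ then G σ.1 else 0),
    Finset.sum_coe_sort s (fun σ => if σ.1 = ℓ then G σ else 0), Finset.sum_sigma,
    Finset.sum_eq_single ℓ]
  · simp
  · intro m _ hm
    simp [hm]
  · exact fun h => absurd hℓ h

/-- The prompt in which the rank-one summands `a q (b q)ᵀ` of the layers `lab q` follow each
other. -/
theorem exists_pair_prompt {d R : ℕ} (lab : Fin R → ℕ)
    (a b : Fin R → EuclideanSpace ℝ (Fin d)) :
    ∃ (u : Fin (2 * R) → EuclideanSpace ℝ (Fin d)) (w : Fin (2 * R) → ℤ),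
      (∀ j, ∃ q, (u j = a q ∨ u j = b q) ∧ (w j = 2 * lab q - 1 ∨ w j = 2 * lab q)) ∧
      (∀ ℓ : ℕ, pairWeight u w ℓ =
        ∑ q, if lab q = ℓ then Matrix.vecMulVec (a q).ofLp (b q).ofLp else 0) ∧
      tailWeight u w = 0 ∧
      (Finset.univ.filter fun j => w j = 1).card = ∑ q, if lab q = 1 then 1 else 0 := by
  let half : Fin (2 * R) → Fin R := fun j => ⟨j / 2, by omega⟩
  let u : Fin (2 * R) → EuclideanSpace ℝ (Fin d) := fun j =>
    if (j : ℕ) % 2 = 0 then a (half j) else b (half j)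
  let w : Fin (2 * R) → ℤ := fun j =>
    if (j : ℕ) % 2 = 0 then 2 * lab (half j) - 1 else 2 * lab (half j)
  let fst : Fin R → Fin (2 * R) := fun q => ⟨2 * q, by omega⟩
  let snd : Fin R → Fin (2 * R) := fun q => ⟨2 * q + 1, by omega⟩
  have hfst : Function.Injective fst := fun p q h => by
    have : 2 * (p : ℕ) = 2 * q := congrArg Fin.val h
    exact Fin.ext (by omega)
  have hhalf : ∀ q, half (fst q) = q := fun q => Fin.ext (by simp [half, fst])
  have hhalf' : ∀ q, half (snd q) = q := fun q => Fin.ext (by simp only [half, snd]; omega)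
  have huf : ∀ q, u (fst q) = a q := fun q => by
    simp only [u, hhalf]
    rw [if_pos (by simp [fst])]
  have hus : ∀ q, u (snd q) = b q := fun q => by
    simp only [u, hhalf']
    rw [if_neg (by simp only [snd]; omega)]
  have hwf : ∀ q, w (fst q) = 2 * lab q - 1 := fun q => by
    simp only [w, hhalf]
    rw [if_pos (by simp [fst])]
  have hws : ∀ q, w (snd q) = 2 * lab q := fun q => by
    simp only [w, hhalf']
    rw [if_neg (by simp only [snd]; omega)]
  have hodd : ∀ j : Fin (2 * R), (j : ℕ) % 2 ≠ 0 → w j = 2 * lab (half j) := fun j hj =>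
    if_neg hj
  have hrange : ∀ j : Fin (2 * R), j ∉ Set.range fst → (j : ℕ) % 2 ≠ 0 := fun j hj h =>
    hj ⟨half j, Fin.ext (by simp only [half, fst]; omega)⟩
  refine ⟨u, w, fun j => ⟨half j, ?_⟩, fun ℓ => ?_, ?_, ?_⟩
  · by_cases h : (j : ℕ) % 2 = 0
    · exact ⟨.inl (if_pos h), .inl (if_pos h)⟩
    · exact ⟨.inr (if_neg h), .inr (if_neg h)⟩
  · symm
    rw [pairWeight]
    refine Fintype.sum_of_injective fst hfst _ _ (fun j hj => ?_) fun q => ?_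
    · have hj' := hodd j (hrange j hj)
      exact Finset.sum_eq_zero fun k _ => if_neg (by omega)
    · rw [Finset.sum_eq_single (snd q)]
      · rw [huf, hus, hwf, hws]
        have hs : (snd q : ℕ) = fst q + 1 := rfl
        exact if_congr ⟨fun h => ⟨hs, by omega, by omega⟩, fun h => by omega⟩ rfl rfl
      · intro k _ hk
        exact if_neg fun h => hk (Fin.ext h.1)
      · simp
  -- The final prompt token is the second member of a pair, so its index is even and differs from 1.
  · refine Finset.sum_eq_zero fun j _ => Finset.sum_eq_zero fun k _ => if_neg fun h => ?_
    have := hodd j (by omega)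
    omega
  · rw [Finset.card_filter]
    symm
    refine Fintype.sum_of_injective fst hfst _ _ (fun j hj => ?_) fun q => ?_
    · have := hodd j (hrange j hj)
      exact if_neg (by omega)
    · rw [hwf]
      exact if_congr (by omega) rfl rfl

end

/-! ### The main theorem -/

theorem mainTheorem3 :
    ∃ C : ℝ, ∀ d : ℕ, 0 < d → ∃ Θ : List (TFLayer (4 * d + 8)),
      Θ.length = 8 ∧
      (∀ θ ∈ Θ, 1 ≤ θ.heads ∧ θ.heads ≤ 8 ∧ 1 ≤ θ.width ∧ (θ.width : ℝ) ≤ C * d) ∧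
      (paramCount Θ : ℝ) ≤ C * d ∧
      (paramMax Θ : ℝ) ≤ C ∧
      -- emulation of the virtual network encoded by an arbitrary prompt
      (∀ (B : ℝ) (L T : ℕ) (U : Set (EuclideanSpace ℝ (Fin d))) (S : ℝ),
        1 ≤ B → 0 < L → 0 < T → U ⊆ Metric.closedBall 0 B →
        max ((d : ℝ) * B ^ (4 * L) * (T : ℝ) ^ (2 * L)) (2 * L) ≤ S →
        ∀ (u : Fin T → EuclideanSpace ℝ (Fin d)) (w : Fin T → ℤ), IsPrompt U L u w →
        ∀ (N : ℕ) (z : Fin N → Fin d → ℝ), 0 < N → (∀ i k, z i k ∈ Set.Icc (0 : ℝ) 1) →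
        ∀ (i : Fin N) (ℓ : ℕ), 1 ≤ ℓ → ℓ ≤ L →
          generatedToken Θ (inputSequence u w z S) (T + N * ℓ + i) =
            token (networkLayer euaf (promptWeight u w i) (z i) ℓ)
              (-(ℓ : ℤ)) (T + N * ℓ + (i + 1)) S) ∧
      -- exact emulation of every coarse network, with a prompt of length twice the sum of the ranks
      (∀ (B : ℝ) (L : ℕ) (r : ℕ → ℕ) (U : Set (EuclideanSpace ℝ (Fin d)))
        (W : ℕ → Matrix (Fin d) (Fin d) ℝ) (S : ℝ),
        1 ≤ B → 0 < L → U ⊆ Metric.closedBall 0 B →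
        (∀ ℓ ∈ Finset.Icc 1 L, W ℓ ∈ coarseWeights (r ℓ) U B) →
        max ((d : ℝ) * ((Finset.Icc 1 L).sup r : ℕ) * B ^ (4 * L)) (2 * L) ≤ S →
        ∃ (u : Fin (2 * ∑ ℓ ∈ Finset.Icc 1 L, r ℓ) → EuclideanSpace ℝ (Fin d))
          (w : Fin (2 * ∑ ℓ ∈ Finset.Icc 1 L, r ℓ) → ℤ), IsPrompt U L u w ∧
        ∀ (N : ℕ) (z : Fin N → Fin d → ℝ), 0 < N → (∀ i k, z i k ∈ Set.Icc (0 : ℝ) 1) →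
        ∀ (i : Fin N) (ℓ : ℕ), 1 ≤ ℓ → ℓ ≤ L →
          generatedToken Θ (inputSequence u w z S)
              ((2 * ∑ ℓ' ∈ Finset.Icc 1 L, r ℓ') + N * ℓ + i) =
            token (networkLayer euaf W (z i) ℓ)
              (-(ℓ : ℤ)) ((2 * ∑ ℓ' ∈ Finset.Icc 1 L, r ℓ') + N * ℓ + (i + 1)) S) := by
  -- The constant is 8 · 144 · 12: eight layers with at most 144(4d + 8) nonzero entries each, and
  -- 4d + 8 ≤ 12d.
  refine ⟨13824, fun d hd => ⟨(LayerSpec.emulator d).map LayerSpec.toLayer, rfl, ?_, ?_, ?_, ?_, ?_⟩⟩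
  · intro θ hθ
    obtain ⟨θ', -, rfl⟩ := List.mem_map.1 hθ
    refine ⟨by simp [LayerSpec.toLayer], by simp [LayerSpec.toLayer],
      by simp only [LayerSpec.toLayer]; omega, ?_⟩
    have h : (4 * d + 8) * 5 ≤ 13824 * d := by omega
    exact_mod_cast h
  · have h := LayerSpec.paramCount_le (LayerSpec.emulator d) LayerSpec.emulator_small
    have h8 : (LayerSpec.emulator d).length = 8 := rfl
    rw [h8] at h
    have h' : paramCount ((LayerSpec.emulator d).map LayerSpec.toLayer) ≤ 13824 * d := by omega
    exact_mod_cast h'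
  · have h := LayerSpec.paramMax_le (LayerSpec.emulator d) LayerSpec.emulator_small
    have h' : (paramMax ((LayerSpec.emulator d).map LayerSpec.toLayer) : ℝ) ≤ 64 := by
      exact_mod_cast h
    linarith
  · intro B L T U S hB hL hT hU hS u w hw N z hN hz i ℓ _ _
    obtain ⟨hS1, hS2⟩ := max_le_iff.1 hS
    have hL' : (1 : ℝ) ≤ L := by exact_mod_cast hL
    have hT' : (1 : ℝ) ≤ T := by exact_mod_cast hT
    have hBp : B ≤ B ^ (4 * L) := le_self_pow₀ hB (by omega)
    have hTp : (T : ℝ) ≤ (T : ℝ) ^ (2 * L) := le_self_pow₀ hT' (by omega)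
    have hdB0 : 0 ≤ d * B := by positivity
    have hTdB : T * (d * B) ≤ S := by
      refine le_trans ?_ hS1
      rw [mul_comm]
      gcongr
    refine generatedToken_emulator_layer u w z hN (by linarith) hB
      (fun j => abs_coord_le hU (hw.1 j)) (fun j => (hw.2 j).1) hz (fun _ => ?_) ?_ i ℓ
    · nlinarith
    · refine le_trans (mul_le_mul_of_nonneg_right ?_ hdB0) hTdB
      exact_mod_cast (Finset.card_le_univ _).trans (Fintype.card_fin T).le
  · intro B L r U W S hB hL hU hW hS
    obtain ⟨hS1, hS2⟩ := max_le_iff.1 hS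
    have hL' : (1 : ℝ) ≤ L := by exact_mod_cast hL
    have hBp : B ≤ B ^ (4 * L) := le_self_pow₀ hB (by omega)
    have hdB0 : 0 ≤ d * B := by positivity
    have hrS : ∀ ℓ ∈ Finset.Icc 1 L, (r ℓ : ℝ) * (d * B) ≤ S := by
      intro ℓ hℓ
      have h1 : r ℓ ≤ (Finset.Icc 1 L).sup r := Finset.le_sup hℓ
      refine le_trans ?_ hS1
      rw [← mul_assoc, mul_comm (r ℓ : ℝ)]
      gcongr
    obtain ⟨e, he, hsum⟩ := exists_labelling L r
    choose! a b hab using fun ℓ hℓ => (hW ℓ hℓ).1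
    -- All rank-one summands of all layers are flattened into one list of adjacent pairs, labelled
    -- by their layer.
    obtain ⟨u, w, huw, hpair, htail, hcard⟩ := exists_pair_prompt (fun q => (e q).1)
      (fun q => a (e q).1 (e q).2) (fun q => b (e q).1 (e q).2)
    have hprompt : IsPrompt U L u w := by
      refine ⟨fun j => ?_, fun j => ?_⟩
      · obtain ⟨q, h | h, -⟩ := huw j
        · rw [h]
          exact (hab _ (he q)).1 _
        · rw [h]
          exact (hab _ (he q)).2.1 _
      · obtain ⟨q, -, h⟩ := huw j
        have := Finset.mem_Icc.1 (he q)
        omega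
    refine ⟨u, w, hprompt, fun N z hN hz i ℓ _ hℓ => ?_⟩
    have hWe : networkLayer euaf W (z i) ℓ = networkLayer euaf (promptWeight u w i) (z i) ℓ := by
      refine networkLayer_congr _ _ _ fun m hm => ?_
      have hm' : m ∈ Finset.Icc 1 L := by
        rw [Finset.mem_Icc] at hm ⊢
        omega
      rw [promptWeight, htail, ite_self, add_zero, hpair,
        hsum (fun σ => Matrix.vecMulVec (a σ.1 σ.2).ofLp (b σ.1 σ.2).ofLp) m hm']
      exact (hab m hm').2.2
    rw [hWe]
    refine generatedToken_emulator_layer u w z hN (by linarith) hB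
      (fun j => abs_coord_le hU (hprompt.1 j)) (fun j => (hprompt.2 j).1) hz (fun hT => ?_) ?_ i ℓ
    -- A nonempty prompt forces some rank to be at least 1, whence dB ≤ S. For the empty prompt the
    -- maximal rank is 0 and the assumption on S gives no such bound.
    · obtain ⟨q, -⟩ := huw ⟨0, hT⟩
      have hr : 1 ≤ r (e q).1 := (e q).2.pos
      have hr' : (1 : ℝ) ≤ r (e q).1 := by exact_mod_cast hr
      have := hrS _ (he q)
      nlinarith
    · have h1 : 1 ∈ Finset.Icc 1 L := Finset.mem_Icc.2 ⟨le_rfl, hL⟩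
      -- The number of tokens of index 1 is the rank of the first layer.
      rw [hcard, hsum (fun _ => 1) 1 h1]
      simpa using hrS 1 h1
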